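/- Notation. Let $n\ge 0$ and let $\mathbb R^n$ carry the Euclidean inner product and norm. For $e\in\mathbb R^n\setminus\{0\}$ and $\alpha\in(0,1]$ let $C_{e,\alpha}=\{x\in\mathbb R^n:\langle x,e\rangle\ge\alpha\|x\|\,\|e\|\}$, and let $\Gamma_{e,\alpha}$ be the set of Lipschitz curves $\gamma:\mathbb R\to\mathbb R^n$ with $\gamma'(t)\in C_{e,\alpha}$ for almost every $t\in\mathbb R$. For open $G\subset\mathbb R^n$ put $w_{e,\alpha}(G)=\sup\{\mathcal H^1(G\cap\gamma(\mathbb R)):\gamma\in\Gamma_{e,\alpha}\}$, where $\mathcal H^1$ is one-dimensional Hausdorff measure, and for arbitrary $E\subset\mathbb R^n$ put $w_{e,\alpha}(E)=\inf\{w_{e,\alpha}(G):G\supset E,\ G\text{ open}\}$; when $e=0$ or $\alpha>1$ put $w_{e,\alpha}(E)=0$. For $x\in E\subset\mathbb R^n$ let $$\mathcal N(E,x)=\{e\in\mathbb R^n:\ \forall\varepsilon>0\ \exists r>0\ \ w_{e,\varepsilon}(B(x,r)\cap E)=0\}.$$ The set $E$ is called cone unrectifiable if $\mathcal N(E,x)\ne\{0\}$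 for every $x\in E$. An $F_\sigma$ set is a countable union of closed sets. Statement. For any $E\subset\mathbb R^n$ that is a countable union of cone unrectifiable $F_\sigma$ sets there is a Lipschitz function $f:\mathbb R^n\to\mathbb R$ that is non-differentiable at every point of $E$ and differentiable at every point of $\mathbb R^n\setminus E$. -/

import Mathlib

open scoped ENNReal NNReal

namespace ConeUnrectifiability

/-- The cone `C_{e,α} = {x : ⟪x, e⟫ ≥ α ‖x‖ ‖e‖}` in `ℝⁿ`. -/
def cone {n : ℕ} (e : EuclideanSpace ℝ (Fin n)) (α : ℝ) : Set (EuclideanSpace ℝ (Fin n)) :=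
  {x | α * ‖x‖ * ‖e‖ ≤ inner ℝ x e}

/-- The family `Γ_{e,α}` of Lipschitz curves `γ : ℝ → ℝⁿ` with `γ'(t) ∈ C_{e,α}` for almost
every `t`. A Lipschitz curve is differentiable almost everywhere, so the value which `deriv`
takes at points of non-differentiability plays no role. -/
def coneCurves {n : ℕ} (e : EuclideanSpace ℝ (Fin n)) (α : ℝ) :
    Set (ℝ → EuclideanSpace ℝ (Fin n)) :=
  {γ | (∃ K : ℝ≥0, LipschitzWith K γ) ∧
    ∀ᵐ t ∂(MeasureTheory.volume : MeasureTheory.Measure ℝ), deriv γ t ∈ cone e α}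

/-- The supremum of the lengths (one-dimensional Hausdorff measures) `H¹(G ∩ γ(ℝ))` over
`γ ∈ Γ_{e,α}`; used for open sets `G`. -/
noncomputable def openWidth {n : ℕ} (e : EuclideanSpace ℝ (Fin n)) (α : ℝ)
    (G : Set (EuclideanSpace ℝ (Fin n))) : ℝ≥0∞ :=
  ⨆ γ ∈ coneCurves e α, MeasureTheory.Measure.hausdorffMeasure 1 (G ∩ Set.range γ)

open Classical in
/-- The `(e,α)`-width `w_{e,α}(E)` of an arbitrary set `E`: the infimum of the widths of the open
sets that contain `E`; by convention it is `0` when `e = 0` or `α > 1`. -/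
noncomputable def width {n : ℕ} (e : EuclideanSpace ℝ (Fin n)) (α : ℝ)
    (E : Set (EuclideanSpace ℝ (Fin n))) : ℝ≥0∞ :=
  if e = 0 ∨ 1 < α then 0
  else ⨅ G : Set (EuclideanSpace ℝ (Fin n)), ⨅ (_ : IsOpen G) (_ : E ⊆ G), openWidth e α G

/-- The set `N(E,x)` of vectors `e` such that for every `ε > 0` there is `r > 0` with
`w_{e,ε}(B(x,r) ∩ E) = 0`. -/
def normals {n : ℕ} (E : Set (EuclideanSpace ℝ (Fin n))) (x : EuclideanSpace ℝ (Fin n)) :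
    Set (EuclideanSpace ℝ (Fin n)) :=
  {e | ∀ ε : ℝ, 0 < ε → ∃ r : ℝ, 0 < r ∧ width e ε (Metric.ball x r ∩ E) = 0}

/-- `E` is cone unrectifiable if `N(E,x) ≠ {0}` for every `x ∈ E`. -/
def ConeUnrectifiable {n : ℕ} (E : Set (EuclideanSpace ℝ (Fin n))) : Prop :=
  ∀ x ∈ E, normals E x ≠ {0}

/-- An `F_σ` set: a countable union of closed sets. -/
def IsFSigma {X : Type*} [TopologicalSpace X] (E : Set X) : Prop :=
  ∃ F : ℕ → Set X, (∀ k, IsClosed (F k)) ∧ E = ⋃ k, F k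

end ConeUnrectifiability

/-! A null width in a direction `e` yields tiny functions with gradient close to `e` near a compact
set `K`. Take an open `G ⊇ K` of width at most `η`, and let the potential at `x` record how much
length a cone curve ending at or above `x` can spend in `G`. It lies in `[0, η]`, has slopes in `[0,
1]` along `e`, slope exactly one while moving along `e` inside `G`, and slopes at most `2α` across
`e`. Mollified, it gives `exists_smooth_potential`.

Subtracting a much smaller potential from such a potential cancels the gradient near `K` but keeps a
visible oscillation at an intermediate scale (`exists_oscillation`). For a compact cone
unrectifiable set `F`, such functions are placed on balls and summed at rapidly decreasing scales
(`exists_oscillatesAt_of_steps`). Every partial sum is almost flat near `F`, yet each point of `F`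
sees an oscillation of definite size infinitely often, so the sum looks flat at some scales and
steep at others; off `F` the sum is locally finite. The flatness errors along balls through one
point are summable because Besicovitch's theorem bounds their number at each precision
(`exists_seq_nullBalls`).

Finally the set is split into countably many compact pieces, and their functions are added with
geometric weights (`exists_lipschitz_of_oscillatesAt`). At a point of the union, the first piece
containing it contributes an oscillation that the later terms are too weak to cancel, while the
earlier terms are differentiable there. -/

namespace ConeUnrectifiability

open MeasureTheory Metric Set Filter Topology

/-! ### Cones, widths, and cone curves parametrized by height. -/

section Cone

variable {n : ℕ} {e : EuclideanSpace ℝ (Fin n)} {α : ℝ}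

lemma zero_mem_cone : (0 : EuclideanSpace ℝ (Fin n)) ∈ cone e α := by simp [cone]

lemma add_mem_cone (hα : 0 ≤ α) {x y : EuclideanSpace ℝ (Fin n)} (hx : x ∈ cone e α)
    (hy : y ∈ cone e α) : x + y ∈ cone e α := by
  simp only [cone, mem_ofPred_eq, inner_add_left] at *
  have : α * ‖x + y‖ * ‖e‖ ≤ α * (‖x‖ + ‖y‖) * ‖e‖ := by
    gcongr
    exact norm_add_le x y
  linarith

lemma smul_mem_cone {c : ℝ} (hc : 0 ≤ c) {x : EuclideanSpace ℝ (Fin n)} (hx : x ∈ cone e α) :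
    c • x ∈ cone e α := by
  simp only [cone, mem_ofPred_eq, inner_smul_left, norm_smul, Real.norm_eq_abs, abs_of_nonneg hc,
    conj_trivial] at *
  nlinarith

lemma self_mem_cone (hα : α ≤ 1) : e ∈ cone e α := by
  simp only [cone, mem_ofPred_eq, real_inner_self_eq_norm_sq]
  nlinarith [norm_nonneg e, mul_nonneg (norm_nonneg e) (norm_nonneg e)]

lemma isClosed_cone : IsClosed (cone e α) :=
  isClosed_le (by fun_prop) (by fun_prop)

lemma cone_smul {c : ℝ} (hc : 0 < c) : cone (c • e) α = cone e α := by
  ext x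
  simp only [cone, mem_ofPred_eq, inner_smul_right, norm_smul, Real.norm_eq_abs, abs_of_pos hc]
  rw [show α * ‖x‖ * (c * ‖e‖) = c * (α * ‖x‖ * ‖e‖) by ring, mul_le_mul_iff_right₀ hc]

lemma width_smul {c : ℝ} (hc : 0 < c) (E : Set (EuclideanSpace ℝ (Fin n))) :
    width (c • e) α E = width e α E := by
  simp only [width, openWidth, coneCurves, cone_smul hc, smul_eq_zero, hc.ne', false_or]

lemma width_mono {A B : Set (EuclideanSpace ℝ (Fin n))} (h : A ⊆ B) :
    width e α A ≤ width e α B := by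
  unfold width
  split_ifs
  · exact le_rfl
  · exact le_iInf fun G => le_iInf₂ fun hG hB =>
      iInf_le_of_le G (iInf₂_le_of_le hG (h.trans hB) le_rfl)

/-- Curves parametrized by the height `⟪·, e⟫` whose increments lie in `cone e α`. -/
structure IsConeSection (e : EuclideanSpace ℝ (Fin n)) (α : ℝ)
    (γ : ℝ → EuclideanSpace ℝ (Fin n)) : Prop where
  sub_mem : ∀ s t, s ≤ t → γ t - γ s ∈ cone e α
  inner_eq : ∀ t, inner ℝ (γ t) e = t

namespace IsConeSection

variable {γ : ℝ → EuclideanSpace ℝ (Fin n)}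

lemma lipschitzWith (hγ : IsConeSection e α γ) (he : ‖e‖ = 1) (hα : 0 < α) :
    LipschitzWith (Real.toNNReal α⁻¹) γ := by
  have key : ∀ s t, s ≤ t → dist (γ t) (γ s) ≤ α⁻¹ * dist t s := by
    intro s t hst
    have h := hγ.sub_mem s t hst
    simp only [cone, mem_ofPred_eq, inner_sub_left, hγ.inner_eq, he, mul_one] at h
    rw [dist_eq_norm, Real.dist_eq, abs_of_nonneg (sub_nonneg.2 hst), inv_mul_eq_div,
      le_div_iff₀ hα]
    linarith
  refine LipschitzWith.of_dist_le_mul fun s t => ?_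
  rw [Real.coe_toNNReal _ (inv_nonneg.2 hα.le)]
  rcases le_total s t with h | h
  · rw [dist_comm, dist_comm s]
    exact key s t h
  · exact key t s h

lemma deriv_mem (hγ : IsConeSection e α γ) (t : ℝ) : deriv γ t ∈ cone e α := by
  by_cases hd : DifferentiableAt ℝ γ t
  · have := hd.hasDerivAt.tendsto_slope_zero_right
    refine isClosed_cone.mem_of_tendsto this ?_
    filter_upwards [self_mem_nhdsWithin] with u hu
    have hu : 0 < u := hu
    exact smul_mem_cone (inv_nonneg.2 hu.le) (hγ.sub_mem _ _ (by linarith))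
  · rw [deriv_zero_of_not_differentiableAt hd]
    exact zero_mem_cone

lemma mem_coneCurves (hγ : IsConeSection e α γ) (he : ‖e‖ = 1) (hα : 0 < α) :
    γ ∈ coneCurves e α :=
  ⟨⟨_, hγ.lipschitzWith he hα⟩, Eventually.of_forall hγ.deriv_mem⟩

/-- The height is 1-Lipschitz and inverts `γ`, so it maps `G ∩ range γ` onto a set containing `γ ⁻¹'
G` without increasing length. Time spent in `G` can thus replace Hausdorff measure. -/
lemma volume_preimage_le (hγ : IsConeSection e α γ) (he : ‖e‖ = 1) (hα : 0 < α)
    (G : Set (EuclideanSpace ℝ (Fin n))) : volume (γ ⁻¹' G) ≤ openWidth e α G := by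
  have hlip : LipschitzWith 1 (fun x : EuclideanSpace ℝ (Fin n) => inner ℝ x e) := by
    refine LipschitzWith.of_dist_le_mul fun x y => ?_
    rw [Real.dist_eq, ← inner_sub_left, dist_eq_norm]
    simpa [he] using abs_real_inner_le_norm (x - y) e
  have hsub : γ ⁻¹' G ⊆ (fun x : EuclideanSpace ℝ (Fin n) => inner ℝ x e) '' (G ∩ range γ) :=
    fun t ht => ⟨γ t, ⟨ht, mem_range_self t⟩, hγ.inner_eq t⟩
  calc volume (γ ⁻¹' G) = Measure.hausdorffMeasure 1 (γ ⁻¹' G) := by rw [hausdorffMeasure_real]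
    _ ≤ Measure.hausdorffMeasure 1
        ((fun x : EuclideanSpace ℝ (Fin n) => inner ℝ x e) '' (G ∩ range γ)) :=
        measure_mono hsub
    _ ≤ Measure.hausdorffMeasure 1 (G ∩ range γ) := by
        simpa using hlip.hausdorffMeasure_image_le zero_le_one (G ∩ range γ)
    _ ≤ openWidth e α G :=
        le_iSup₂ (f := fun γ (_ : γ ∈ coneCurves e α) =>
          Measure.hausdorffMeasure 1 (G ∩ range γ)) γ (hγ.mem_coneCurves he hα)

/-- Follow `γ` up to height `a`, then go straight in the direction `v`. -/
lemma extend (hγ : IsConeSection e α γ) (hα : 0 ≤ α) {v : EuclideanSpace ℝ (Fin n)}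
    (hv : v ∈ cone e α) (hve : inner ℝ v e = 1) (a : ℝ) :
    IsConeSection e α (fun t => γ (min t a) + max (t - a) 0 • v) where
  sub_mem s t hst := by
    have : γ (min t a) + max (t - a) 0 • v - (γ (min s a) + max (s - a) 0 • v) =
        (γ (min t a) - γ (min s a)) + (max (t - a) 0 - max (s - a) 0) • v := by
      rw [sub_smul]; abel
    rw [this]
    exact add_mem_cone hα (hγ.sub_mem _ _ (min_le_min_right _ hst))
      (smul_mem_cone (sub_nonneg.2 (max_le_max_right _ (by linarith))) hv)
  inner_eq t := by
    rw [inner_add_left, hγ.inner_eq, inner_smul_left, hve]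
    simp only [conj_trivial, mul_one]
    rcases le_total t a with h | h
    · rw [min_eq_left h, max_eq_right (by linarith)]; ring
    · rw [min_eq_right h, max_eq_left (by linarith)]; ring

end IsConeSection

lemma isConeSection_line (he : ‖e‖ = 1) (hα : α ≤ 1) (x : EuclideanSpace ℝ (Fin n)) :
    IsConeSection e α (fun t => x + (t - inner ℝ x e) • e) where
  sub_mem s t hst := by
    rw [add_sub_add_left_eq_sub, ← sub_smul]
    exact smul_mem_cone (by linarith) (self_mem_cone hα)
  inner_eq t := by
    rw [inner_add_left, inner_smul_left, real_inner_self_eq_norm_sq, he]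
    simp

/-- The values whose supremum is the potential of `G` at `x`. -/
def potentialValues (e : EuclideanSpace ℝ (Fin n)) (α : ℝ) (G : Set (EuclideanSpace ℝ (Fin n)))
    (x : EuclideanSpace ℝ (Fin n)) : Set ℝ :=
  {v | ∃ γ τ, IsConeSection e α γ ∧ 0 ≤ τ ∧ γ (inner ℝ x e + τ) = x + τ • e ∧
    v = volume.real (Iic (inner ℝ x e + τ) ∩ γ ⁻¹' G) - τ}

/-- The potential of `G` at `x`: the largest length that curves ending above `x` spend in `G`,
less the distance of their endpoint from `x`. -/
noncomputable def potential (e : EuclideanSpace ℝ (Fin n)) (α : ℝ)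
    (G : Set (EuclideanSpace ℝ (Fin n))) (x : EuclideanSpace ℝ (Fin n)) : ℝ :=
  sSup (potentialValues e α G x)

/-! ### Slope estimates for the potential. -/

section Potential

variable {G : Set (EuclideanSpace ℝ (Fin n))} {η : ℝ}

lemma potentialValues_nonempty (he : ‖e‖ = 1) (hα : α ≤ 1) (x : EuclideanSpace ℝ (Fin n)) :
    (potentialValues e α G x).Nonempty :=
  ⟨_, _, 0, isConeSection_line he hα x, le_rfl, by simp, rfl⟩

lemma exists_mem_potentialValues_nonneg (he : ‖e‖ = 1) (hα : α ≤ 1)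
    (x : EuclideanSpace ℝ (Fin n)) : ∃ v ∈ potentialValues e α G x, 0 ≤ v :=
  ⟨_, ⟨_, 0, isConeSection_line he hα x, le_rfl, by simp, rfl⟩, by simp⟩

variable (he : ‖e‖ = 1) (hα0 : 0 < α) (hα : α ≤ 1) (hG : openWidth e α G ≤ ENNReal.ofReal η)
include he hα0 hG

lemma volume_preimage_ne_top {γ : ℝ → EuclideanSpace ℝ (Fin n)} (hγ : IsConeSection e α γ)
    (s : Set ℝ) : volume (s ∩ γ ⁻¹' G) ≠ ∞ :=
  (((measure_mono inter_subset_right).trans (hγ.volume_preimage_le he hα0 G)).trans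
    hG).trans_lt ENNReal.ofReal_lt_top |>.ne

lemma le_of_mem_potentialValues (hη : 0 ≤ η) {x : EuclideanSpace ℝ (Fin n)} {v : ℝ}
    (hv : v ∈ potentialValues e α G x) : v ≤ η := by
  obtain ⟨γ, τ, hγ, hτ, -, rfl⟩ := hv
  have : volume.real (Iic (inner ℝ x e + τ) ∩ γ ⁻¹' G) ≤ η :=
    ENNReal.toReal_le_of_le_ofReal hη
      (((measure_mono inter_subset_right).trans (hγ.volume_preimage_le he hα0 G)).trans hG)
  linarith

lemma bddAbove_potentialValues (hη : 0 ≤ η) (x : EuclideanSpace ℝ (Fin n)) :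
    BddAbove (potentialValues e α G x) :=
  ⟨η, fun _ hv => le_of_mem_potentialValues he hα0 hG hη hv⟩

include hα

lemma potential_nonneg (hη : 0 ≤ η) (x : EuclideanSpace ℝ (Fin n)) : 0 ≤ potential e α G x := by
  obtain ⟨v, hv, h0⟩ := exists_mem_potentialValues_nonneg (G := G) he hα x
  exact h0.trans (le_csSup (bddAbove_potentialValues he hα0 hG hη x) hv)

lemma potential_le (hη : 0 ≤ η) (x : EuclideanSpace ℝ (Fin n)) : potential e α G x ≤ η :=
  csSup_le (potentialValues_nonempty he hα x)
    fun _ hv => le_of_mem_potentialValues he hα0 hG hη hv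

lemma potential_le_add_of_forall (hη : 0 ≤ η) {x y : EuclideanSpace ℝ (Fin n)} {c : ℝ}
    (h : ∀ v ∈ potentialValues e α G x, ∃ w ∈ potentialValues e α G y, v ≤ w + c) :
    potential e α G x ≤ potential e α G y + c := by
  refine csSup_le (potentialValues_nonempty he hα x) fun v hv => ?_
  obtain ⟨w, hw, hvw⟩ := h v hv
  exact hvw.trans (by
    gcongr
    exact le_csSup (bddAbove_potentialValues he hα0 hG hη y) hw)

/-- A curve ending at `x + τ • e` can be continued along `y - x` to `y + τ • e`, with the same
penalty `τ` and no loss of time in `G`. -/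
lemma potential_mono (hη : 0 ≤ η) {x y : EuclideanSpace ℝ (Fin n)} (hxy : y - x ∈ cone e α) :
    potential e α G x ≤ potential e α G y := by
  rcases eq_or_ne x y with rfl | hne
  · exact le_rfl
  suffices potential e α G x ≤ potential e α G y + 0 by simpa using this
  refine potential_le_add_of_forall he hα0 hα hG hη ?_
  rintro _ ⟨γ, τ, hγ, hτ, hend, rfl⟩
  have hpos : 0 < inner ℝ (y - x) e := by
    have h := hxy
    simp only [cone, mem_ofPred_eq, he, mul_one] at h
    have : 0 < α * ‖y - x‖ := mul_pos hα0 (norm_pos_iff.2 (sub_ne_zero.2 hne.symm))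
    linarith
  set d := inner ℝ (y - x) e with hd
  have hdxy : inner ℝ y e = inner ℝ x e + d := by rw [hd, inner_sub_left]; ring
  set a := inner ℝ x e + τ with ha
  have hγ' := hγ.extend hα0.le (v := d⁻¹ • (y - x)) (smul_mem_cone (inv_nonneg.2 hpos.le) hxy)
    (by rw [inner_smul_left, ← hd]; simp [hpos.ne']) a
  refine ⟨_, ⟨_, τ, hγ', hτ, ?_, rfl⟩, ?_⟩
  · have h1 : min (inner ℝ y e + τ) a = a := min_eq_right (by rw [hdxy]; linarith)
    have h2 : max (inner ℝ y e + τ - a) 0 = d := by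
      rw [hdxy, ha, max_eq_left] <;> linarith
    simp only [h1, h2]
    rw [hend, smul_smul, mul_inv_cancel₀ hpos.ne', one_smul]
    abel
  · rw [add_zero]
    refine sub_le_sub_right (measureReal_mono ?_ (volume_preimage_ne_top he hα0 hG hγ' _)) _
    rintro t ⟨ht, htG⟩
    have hta : t ≤ a := ht
    refine ⟨?_, ?_⟩
    · rw [mem_Iic, hdxy]; linarith
    · simpa [min_eq_left hta, max_eq_right (sub_nonpos.2 hta)] using htG

/-- A curve competing at the higher point competes at `x` too, with penalty larger by `t`. This is
why endpoints above `x` are admitted. -/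
lemma potential_add_smul_le (hη : 0 ≤ η) (x : EuclideanSpace ℝ (Fin n)) {t : ℝ} (ht : 0 ≤ t) :
    potential e α G (x + t • e) ≤ potential e α G x + t := by
  have hh : inner ℝ (x + t • e) e = inner ℝ x e + t := by
    rw [inner_add_left, inner_smul_left, real_inner_self_eq_norm_sq, he]; simp
  refine potential_le_add_of_forall he hα0 hα hG hη ?_
  rintro _ ⟨γ, τ, hγ, hτ, hend, rfl⟩
  rw [hh, add_assoc] at hend ⊢
  refine ⟨_, ⟨γ, t + τ, hγ, by positivity, ?_, rfl⟩, by linarith⟩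
  rw [hend, add_smul, add_assoc]

lemma potential_add_le (hη : 0 ≤ η) {x : EuclideanSpace ℝ (Fin n)} {t : ℝ}
    (hseg : ∀ s ∈ Icc 0 t, x + s • e ∈ G) :
    potential e α G x + t ≤ potential e α G (x + t • e) := by
  have hh : inner ℝ (x + t • e) e = inner ℝ x e + t := by
    rw [inner_add_left, inner_smul_left, real_inner_self_eq_norm_sq, he]; simp
  suffices potential e α G x ≤ potential e α G (x + t • e) + -t by linarith
  refine potential_le_add_of_forall he hα0 hα hG hη ?_
  rintro _ ⟨γ, τ, hγ, hτ, hend, rfl⟩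
  rcases le_total t τ with h | h
  · refine ⟨_, ⟨γ, τ - t, hγ, by linarith, ?_, rfl⟩, ?_⟩
    · rw [hh, show inner ℝ x e + t + (τ - t) = inner ℝ x e + τ by ring, hend, sub_smul]
      abel
    · rw [hh, show inner ℝ x e + t + (τ - t) = inner ℝ x e + τ by ring]
      linarith
  -- The curve stops below `x + t • e`. Going straight up gains length `t - τ` in `G` and removes
  -- the penalty `τ`, a total gain of `t`.
  · set a := inner ℝ x e + τ with ha
    have hγ' := hγ.extend hα0.le (v := e) (self_mem_cone hα)
      (by rw [real_inner_self_eq_norm_sq, he]; simp) a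
    refine ⟨_, ⟨_, 0, hγ', le_rfl, ?_, rfl⟩, ?_⟩
    · have h1 : min (inner ℝ (x + t • e) e + 0) a = a := min_eq_right (by rw [hh]; linarith)
      have h2 : max (inner ℝ (x + t • e) e + 0 - a) 0 = t - τ := by
        rw [hh, ha, max_eq_left] <;> linarith
      simp only [h1, h2]
      rw [hend, sub_smul, zero_smul]
      abel
    · have hsub : (Iic a ∩ γ ⁻¹' G) ∪ Ioc a (inner ℝ x e + t) ⊆
          Iic (inner ℝ (x + t • e) e + 0) ∩
            (fun t => γ (min t a) + max (t - a) 0 • e) ⁻¹' G := by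
        rintro s (⟨hs, hsG⟩ | ⟨hs1, hs2⟩)
        · have hsa : s ≤ a := hs
          refine ⟨?_, ?_⟩
          · rw [mem_Iic, hh]; linarith
          · simpa [min_eq_left hsa, max_eq_right (sub_nonpos.2 hsa)] using hsG
        · refine ⟨?_, ?_⟩
          · rw [mem_Iic, hh]; linarith
          · rw [mem_preimage, min_eq_right hs1.le, max_eq_left (by linarith), hend, add_assoc,
              ← add_smul]
            exact hseg _ ⟨by linarith, by linarith⟩
      have hdis : Disjoint (Iic a ∩ γ ⁻¹' G) (Ioc a (inner ℝ x e + t)) :=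
        disjoint_left.2 fun s hs hs' => absurd hs.1 (not_le.2 hs'.1)
      have h1 := measureReal_mono (μ := volume) hsub (volume_preimage_ne_top he hα0 hG hγ' _)
      rw [measureReal_union hdis measurableSet_Ioc (volume_preimage_ne_top he hα0 hG hγ _)
        (by simp), Real.volume_real_Ioc_of_le (by linarith)] at h1
      linarith

/-- A horizontal step becomes a cone vector after climbing `2 * α` times its length, since `α * (1 +
2 * α) ≤ 2 * α`. Monotonicity along the cone and slope at most one along `e` then bound the change
by that climb. -/
lemma abs_potential_add_sub_le (hα2 : α ≤ 1 / 2) (hη : 0 ≤ η) (x : EuclideanSpace ℝ (Fin n))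
    {p : EuclideanSpace ℝ (Fin n)} (hp : inner ℝ p e = 0) :
    |potential e α G (x + p) - potential e α G x| ≤ 2 * α * ‖p‖ := by
  have key : ∀ z q : EuclideanSpace ℝ (Fin n), inner ℝ q e = 0 →
      potential e α G (z + q) ≤ potential e α G z + 2 * α * ‖q‖ := by
    intro z q hq
    have hmem : -q + (2 * α * ‖q‖) • e ∈ cone e α := by
      simp only [cone, mem_ofPred_eq, inner_add_left, inner_neg_left, inner_smul_left, hq,
        real_inner_self_eq_norm_sq, he, conj_trivial]
      have h1 : ‖-q + (2 * α * ‖q‖) • e‖ ≤ ‖q‖ + 2 * α * ‖q‖ := by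
        refine (norm_add_le _ _).trans ?_
        rw [norm_neg, norm_smul, he, Real.norm_eq_abs, abs_of_nonneg (by positivity), mul_one]
      have h2 : α * ‖-q + (2 * α * ‖q‖) • e‖ ≤ α * (‖q‖ + 2 * α * ‖q‖) := by gcongr
      have h3 : α * (α * ‖q‖) ≤ 1 / 2 * (α * ‖q‖) := by gcongr
      nlinarith
    refine (potential_mono he hα0 hα hG hη (y := z + (2 * α * ‖q‖) • e) ?_).trans
      (potential_add_smul_le he hα0 hα hG hη z (by positivity))
    convert hmem using 1
    abel
  have h1 := key x p hp
  have h2 := key (x + p) (-p) (by rw [inner_neg_left, hp, neg_zero])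
  rw [add_neg_cancel_right, norm_neg] at h2
  rw [abs_le]
  constructor <;> linarith

end Potential

end Cone

end ConeUnrectifiability

/-! ### Mollification of the potential. -/

namespace ConeUnrectifiability

open MeasureTheory Metric Set Filter Topology
open scoped Convolution

section Smoothing

variable {X : Type*} [NormedAddCommGroup X] [InnerProductSpace ℝ X]

lemma norm_sub_smul_innerSL_le {e : X} (he : ‖e‖ = 1) {L : X →L[ℝ] ℝ} {c : ℝ} (hc : 0 ≤ c)
    (hL : ∀ p, inner ℝ e p = 0 → |L p| ≤ c * ‖p‖) : ‖L - L e • innerSL ℝ e‖ ≤ c := by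
  refine ContinuousLinearMap.opNorm_le_bound _ hc fun v => ?_
  set p := v - inner ℝ e v • e with hp
  have hpe : inner ℝ e p = 0 := by
    rw [hp, inner_sub_right, inner_smul_right, real_inner_self_eq_norm_sq, he]; ring
  have hLp : (L - L e • innerSL ℝ e) v = L p := by
    simp [hp]; ring
  have hpv : ‖p‖ ≤ ‖v‖ := by
    have : ‖v‖ ^ 2 = ‖p‖ ^ 2 + (inner ℝ e v) ^ 2 := by
      have hv : v = p + inner ℝ e v • e := by rw [hp]; abel
      conv_lhs => rw [hv]
      rw [norm_add_sq_real, inner_smul_right, real_inner_comm e p, hpe, norm_smul, he, mul_one,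
        Real.norm_eq_abs, sq_abs]
      ring
    exact le_of_sq_le_sq (by nlinarith [sq_nonneg (inner ℝ e v)]) (norm_nonneg v)
  rw [hLp, Real.norm_eq_abs]
  exact (hL p hpe).trans (by gcongr)

lemma fderiv_apply_le {ψ : X → ℝ} {x v : X} {b : ℝ} (hd : DifferentiableAt ℝ ψ x)
    (h : ∀ᶠ t in 𝓝[>] (0 : ℝ), ψ (x + t • v) - ψ x ≤ t * b) : fderiv ℝ ψ x v ≤ b := by
  have := (hd.hasFDerivAt.hasLineDerivAt v).tendsto_slope_zero_right
  refine le_of_tendsto this ?_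
  filter_upwards [h, self_mem_nhdsWithin] with t ht ht0
  have ht0 : 0 < t := ht0
  rw [smul_eq_mul, inv_mul_le_iff₀ ht0]
  exact ht

lemma le_fderiv_apply {ψ : X → ℝ} {x v : X} {b : ℝ} (hd : DifferentiableAt ℝ ψ x)
    (h : ∀ᶠ t in 𝓝[>] (0 : ℝ), t * b ≤ ψ (x + t • v) - ψ x) : b ≤ fderiv ℝ ψ x v := by
  have := (hd.hasFDerivAt.hasLineDerivAt v).tendsto_slope_zero_right
  refine ge_of_tendsto this ?_
  filter_upwards [h, self_mem_nhdsWithin] with t ht ht0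
  have ht0 : 0 < t := ht0
  rw [smul_eq_mul, le_inv_mul_iff₀ ht0]
  exact ht

variable [FiniteDimensional ℝ X] [MeasurableSpace X] [BorelSpace X]

lemma integrable_normed_mul {δ : ContDiffBump (0 : X)} {φ : X → ℝ} (hφ : Continuous φ) (x : X) :
    Integrable (fun u => δ.normed volume u * φ (x - u)) :=
  Continuous.integrable_of_hasCompactSupport
    (δ.continuous_normed.mul (by fun_prop)) δ.hasCompactSupport_normed.mul_right

/-- Mollification. -/
noncomputable def mollify (δ : ContDiffBump (0 : X)) (φ : X → ℝ) (x : X) : ℝ :=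
  ∫ u, δ.normed volume u * φ (x - u)

lemma contDiff_mollify (δ : ContDiffBump (0 : X)) {φ : X → ℝ} (hφ : Continuous φ) :
    ContDiff ℝ 1 (mollify δ φ) :=
  δ.hasCompactSupport_normed.contDiff_convolution_left (ContinuousLinearMap.lsmul ℝ ℝ)
    δ.contDiff_normed hφ.locallyIntegrable

/-- Increments of the mollification are averages of increments of `φ` at nearby translates, so
one-sided bounds survive. -/
lemma mollify_sub_le {δ : ContDiffBump (0 : X)} {φ : X → ℝ} (hφ : Continuous φ) {x y : X} {b : ℝ}
    (h : ∀ u ∈ ball (0 : X) δ.rOut, φ (y - u) - φ (x - u) ≤ b) :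
    mollify δ φ y - mollify δ φ x ≤ b := by
  rw [mollify, mollify, ← integral_sub (integrable_normed_mul hφ y) (integrable_normed_mul hφ x)]
  calc _ ≤ ∫ u, δ.normed volume u * b := by
        refine integral_mono ((integrable_normed_mul hφ y).sub (integrable_normed_mul hφ x))
          (δ.integrable_normed.mul_const b) fun u => ?_
        by_cases hu : u ∈ ball (0 : X) δ.rOut
        · have := mul_le_mul_of_nonneg_left (h u hu) (δ.nonneg_normed (μ := volume) u)
          simp only
          linarith
        · have : δ.normed volume u = 0 := by
            by_contra h0
            exact hu (δ.support_normed_eq (μ := volume) ▸ h0)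
          simp [this]
    _ = b := by rw [integral_mul_const, δ.integral_normed, one_mul]

lemma le_mollify_sub {δ : ContDiffBump (0 : X)} {φ : X → ℝ} (hφ : Continuous φ) {x y : X} {b : ℝ}
    (h : ∀ u ∈ ball (0 : X) δ.rOut, b ≤ φ (y - u) - φ (x - u)) :
    b ≤ mollify δ φ y - mollify δ φ x := by
  have := mollify_sub_le (δ := δ) hφ (x := y) (y := x) (b := -b)
    fun u hu => by linarith [h u hu]
  linarith

lemma mollify_mem_Icc {δ : ContDiffBump (0 : X)} {φ : X → ℝ} (hφ : Continuous φ) {a b : ℝ}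
    (h : ∀ x, φ x ∈ Icc a b) (x : X) : mollify δ φ x ∈ Icc a b := by
  have hI := integrable_normed_mul (δ := δ) hφ x
  have hc (c : ℝ) : ∫ u, δ.normed volume u * c = c := by
    rw [integral_mul_const, δ.integral_normed, one_mul]
  constructor
  · rw [← hc a]
    exact integral_mono (δ.integrable_normed.mul_const a) hI fun u =>
      mul_le_mul_of_nonneg_left (h _).1 (δ.nonneg_normed u)
  · rw [← hc b]
    exact integral_mono hI (δ.integrable_normed.mul_const b) fun u =>
      mul_le_mul_of_nonneg_left (h _).2 (δ.nonneg_normed u)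

end Smoothing

section

variable {n : ℕ} {e : EuclideanSpace ℝ (Fin n)} {α : ℝ}

lemma continuous_potential {G : Set (EuclideanSpace ℝ (Fin n))} {η : ℝ} (he : ‖e‖ = 1)
    (hα0 : 0 < α) (hα : α ≤ 1 / 2) (hη : 0 ≤ η) (hG : openWidth e α G ≤ ENNReal.ofReal η) :
    Continuous (potential e α G) := by
  have hα1 : α ≤ 1 := by linarith
  have key : ∀ x y : EuclideanSpace ℝ (Fin n),
      potential e α G y - potential e α G x ≤ 3 * ‖y - x‖ := by
    intro x y
    set t := inner ℝ (y - x) e with ht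
    set p := (y - x) - t • e with hp
    have htle : |t| ≤ ‖y - x‖ := by simpa [he] using abs_real_inner_le_norm (y - x) e
    have hple : ‖p‖ ≤ 2 * ‖y - x‖ := by
      refine (norm_sub_le _ _).trans ?_
      rw [norm_smul, he, Real.norm_eq_abs]
      linarith
    have hpe : inner ℝ p e = 0 := by
      rw [hp, inner_sub_left, inner_smul_left, real_inner_self_eq_norm_sq, he]
      simp [ht]
    have h1 := (abs_le.1 (abs_potential_add_sub_le he hα0 hα1 hG hα hη (x + t • e) hpe)).2
    have hy : x + t • e + p = y := by rw [hp]; abel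
    rw [hy] at h1
    have h2 : potential e α G (x + t • e) ≤ potential e α G x + |t| := by
      rcases le_total 0 t with h | h
      · rw [abs_of_nonneg h]
        exact potential_add_smul_le he hα0 hα1 hG hη x h
      · have := potential_mono he hα0 hα1 hG hη (x := x + t • e) (y := x) (by
          have := smul_mem_cone (c := -t) (by linarith) (self_mem_cone (e := e) hα1)
          rw [neg_smul] at this
          convert this using 1
          abel)
        linarith [abs_nonneg t]
    have h3 : 2 * α * ‖p‖ ≤ 1 * ‖p‖ := by gcongr; linarith
    linarith
  refine (LipschitzWith.of_dist_le_mul (K := 3) fun x y => ?_).continuous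
  rw [Real.dist_eq, abs_le, dist_eq_norm]
  have h1 := key x y
  have h2 := key y x
  rw [norm_sub_rev] at h1
  push_cast
  constructor <;> linarith

theorem exists_smooth_potential {K : Set (EuclideanSpace ℝ (Fin n))} (hK : IsCompact K)
    (he : ‖e‖ = 1) (hα0 : 0 < α) (hα : α ≤ 1 / 2) (hw : width e α K = 0) {η : ℝ} (hη : 0 < η) :
    ∃ φ : EuclideanSpace ℝ (Fin n) → ℝ, Differentiable ℝ φ ∧ (∀ x, φ x ∈ Icc 0 η) ∧
      (∀ x, ∃ s ∈ Icc (0 : ℝ) 1, ‖fderiv ℝ φ x - s • innerSL ℝ e‖ ≤ 2 * α) ∧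
      ∃ V, IsOpen V ∧ K ⊆ V ∧ ∀ x ∈ V, ‖fderiv ℝ φ x - innerSL ℝ e‖ ≤ 2 * α := by
  have hα1 : α ≤ 1 := by linarith
  have he0 : e ≠ 0 := by rintro rfl; simp at he
  obtain ⟨G, hGo, hKG, hG⟩ : ∃ G, IsOpen G ∧ K ⊆ G ∧ openWidth e α G ≤ ENNReal.ofReal η := by
    rw [width, if_neg (by simp [he0, hα1])] at hw
    have : (⨅ G : Set (EuclideanSpace ℝ (Fin n)), ⨅ (_ : IsOpen G) (_ : K ⊆ G),
        openWidth e α G) < ENNReal.ofReal η := by rw [hw]; simpa using hη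
    simp only [iInf_lt_iff] at this
    obtain ⟨G, h1, h2, h3⟩ := this
    exact ⟨G, h1, h2, h3.le⟩
  obtain ⟨r, hr, hrG⟩ := hK.exists_thickening_subset_open hGo hKG
  -- Three displacements below `r / 3` must fit in the `r`-thickening of `K`: from `K` to the point,
  -- the mollifier's shift, and the segment along `e`.
  let δ : ContDiffBump (0 : EuclideanSpace ℝ (Fin n)) := ⟨r / 6, r / 3, by linarith, by linarith⟩
  have hδ : δ.rOut = r / 3 := rfl
  have hcont := continuous_potential he hα0 hα hη.le hG
  have hd := (contDiff_mollify δ hcont).differentiable (by simp)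
  have hsub : ∀ x v u : EuclideanSpace ℝ (Fin n), x + v - u = x - u + v := fun x v u => by abel
  have hp : ∀ x p, inner ℝ e p = 0 → |fderiv ℝ (mollify δ (potential e α G)) x p| ≤
      2 * α * ‖p‖ := by
    intro x p hp
    have hb : ∀ t : ℝ, 0 < t → ∀ z,
        |potential e α G (z + t • p) - potential e α G z| ≤ t * (2 * α * ‖p‖) := by
      intro t ht z
      refine (abs_potential_add_sub_le he hα0 hα1 hG hα hη.le z (p := t • p) ?_).trans_eq ?_
      · rw [inner_smul_left, real_inner_comm, hp, mul_zero]
      · rw [norm_smul, Real.norm_eq_abs, abs_of_pos ht]; ring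
    rw [abs_le]
    constructor
    · refine le_fderiv_apply (hd x) ?_
      filter_upwards [self_mem_nhdsWithin] with t ht
      refine le_mollify_sub hcont fun u _ => ?_
      rw [hsub]
      linarith [(abs_le.1 (hb t ht (x - u))).1]
    · refine fderiv_apply_le (hd x) ?_
      filter_upwards [self_mem_nhdsWithin] with t ht
      refine mollify_sub_le hcont fun u _ => ?_
      rw [hsub]
      exact (abs_le.1 (hb t ht (x - u))).2
  have he1 : ∀ x, fderiv ℝ (mollify δ (potential e α G)) x e ≤ 1 := by
    intro x
    refine fderiv_apply_le (hd x) ?_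
    filter_upwards [self_mem_nhdsWithin] with t ht
    refine mollify_sub_le hcont fun u _ => ?_
    have ht : 0 < t := ht
    rw [hsub]
    linarith [potential_add_smul_le he hα0 hα1 hG hη.le (x - u) ht.le]
  refine ⟨mollify δ (potential e α G), hd, mollify_mem_Icc hcont fun x =>
    ⟨potential_nonneg he hα0 hα1 hG hη.le x, potential_le he hα0 hα1 hG hη.le x⟩, fun x => ?_,
    thickening (r / 3) K, isOpen_thickening, self_subset_thickening (by linarith) K,
    fun x hx => ?_⟩
  · refine ⟨_, ⟨?_, he1 x⟩, norm_sub_smul_innerSL_le he (by positivity) (hp x)⟩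
    refine le_fderiv_apply (hd x) ?_
    filter_upwards [self_mem_nhdsWithin] with t ht
    refine le_mollify_sub hcont fun u _ => ?_
    have ht : 0 < t := ht
    rw [hsub, mul_zero, sub_nonneg]
    refine potential_mono he hα0 hα1 hG hη.le ?_
    rw [add_sub_cancel_left]
    exact smul_mem_cone ht.le (self_mem_cone hα1)
  · have : fderiv ℝ (mollify δ (potential e α G)) x e = 1 := by
      refine le_antisymm (he1 x) (le_fderiv_apply (hd x) ?_)
      filter_upwards [Ioo_mem_nhdsGT (show 0 < r / 3 by linarith)] with t ht
      refine le_mollify_sub hcont fun u hu => ?_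
      rw [hsub, mul_one]
      have := potential_add_le he hα0 hα1 hG hη.le (x := x - u) (t := t) fun s hs => ?_
      · linarith
      · apply hrG
        obtain ⟨k, hk, hxk⟩ := mem_thickening_iff.1 hx
        refine mem_thickening_iff.2 ⟨k, hk, ?_⟩
        rw [mem_ball_zero_iff, hδ] at hu
        rw [dist_eq_norm] at hxk ⊢
        have h1 : x - u + s • e - k = (x - k) + (-u) + s • e := by abel
        have h2 : ‖s • e‖ = s := by
          rw [norm_smul, he, mul_one, Real.norm_eq_abs, abs_of_nonneg hs.1]
        rw [h1]
        have h3 := norm_add₃_le (a := x - k) (b := -u) (c := s • e)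
        rw [norm_neg, h2] at h3
        linarith [hs.2, ht.2]
    simpa [this] using norm_sub_smul_innerSL_le he (by positivity) (hp x)

end

end ConeUnrectifiability

/-! ### A small function, flat near `F`, that oscillates at one scale. -/

namespace ConeUnrectifiability

open MeasureTheory Metric Set Filter Topology
open scoped Manifold ContDiff

section Cutoff

variable {X : Type*} [NormedAddCommGroup X] [InnerProductSpace ℝ X] [FiniteDimensional ℝ X]

lemma exists_cutoff {K U : Set X} (hK : IsCompact K) (hU : IsOpen U) (hKU : K ⊆ U) :
    ∃ θ : X → ℝ, ContDiff ℝ 1 θ ∧ HasCompactSupport θ ∧ tsupport θ ⊆ U ∧ (∀ x, θ x ∈ Icc 0 1) ∧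
      ∃ V, IsOpen V ∧ K ⊆ V ∧ ∀ x ∈ V, θ x = 1 := by
  obtain ⟨L, hL, hKL, hLU⟩ := exists_compact_between hK hU hKU
  obtain ⟨θ, h1, h0, hθ⟩ := exists_contMDiffMap_one_nhds_of_subset_interior (n := 1) 𝓘(ℝ, X)
    hK.isClosed hKL
  have hts : tsupport θ ⊆ L := closure_minimal
    (fun x hx => by by_contra h; exact hx (h0 x h)) hL.isClosed
  obtain ⟨V, hV, hKV, hV1⟩ := mem_nhdsSet_iff_exists.1 h1
  exact ⟨θ, θ.contMDiff.contDiff, HasCompactSupport.of_support_subset_isCompact hL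
    ((subset_tsupport _).trans hts), hts.trans hLU, hθ, V, hV, hKV, fun x hx => hV1 hx⟩

omit [FiniteDimensional ℝ X] in
lemma exists_norm_fderiv_le {θ : X → ℝ} (h : ContDiff ℝ 1 θ) (hc : HasCompactSupport θ) :
    ∃ C, 0 < C ∧ ∀ x, ‖fderiv ℝ θ x‖ ≤ C := by
  obtain ⟨C, hC⟩ := ContDiff.lipschitzWith_of_hasCompactSupport hc h (by simp)
  exact ⟨C + 1, by positivity, fun x => (norm_fderiv_le_of_lipschitz ℝ hC).trans (by simp)⟩

end Cutoff

variable {n : ℕ} {e : EuclideanSpace ℝ (Fin n)} {α : ℝ}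

/-- A small smooth function which is nearly flat in a neighbourhood of `F`, but which has slope
about one on a small scale at the points near which `χ` is one. -/
theorem exists_oscillation {F : Set (EuclideanSpace ℝ (Fin n))} (hF : IsCompact F)
    (he : ‖e‖ = 1) (hα0 : 0 < α) (hα : α ≤ 1 / 6) {χ : EuclideanSpace ℝ (Fin n) → ℝ}
    (hχ : ContDiff ℝ 1 χ) (hχc : HasCompactSupport χ) (hχ01 : ∀ x, χ x ∈ Icc 0 1)
    (hw : width e α (F ∩ tsupport χ) = 0) {η r₀ : ℝ} (hη : 0 < η) (hr₀ : 0 < r₀) :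
    ∃ h : EuclideanSpace ℝ (Fin n) → ℝ, Differentiable ℝ h ∧ (∀ x, |h x| ≤ η) ∧
      tsupport h ⊆ tsupport χ ∧ (∀ x, ‖fderiv ℝ h x‖ ≤ 2) ∧
      (∃ W, IsOpen W ∧ F ⊆ W ∧ ∀ x ∈ W, ‖fderiv ℝ h x‖ ≤ 6 * α) ∧
      ∃ ρ, 0 < ρ ∧ ρ < η ∧ ∀ x ∈ F, (∀ y ∈ ball x r₀, χ y = 1) →
        ρ / 2 ≤ |h (x + ρ • e) - h x| := by
  set T := tsupport χ with hT
  have hTcl : IsClosed T := isClosed_tsupport _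
  have hK : IsCompact (F ∩ T) := hF.inter_right hTcl
  obtain ⟨C, hC0, hC⟩ := exists_norm_fderiv_le hχ hχc
  obtain ⟨φ, hφd, hφ01, hφs, V, hVo, hKV, hV⟩ := exists_smooth_potential hK he hα0
    (by linarith) hw (η := min (η / 2) (α / C)) (by positivity)
  obtain ⟨r, hr, hrV⟩ := hK.exists_thickening_subset_open hVo hKV
  obtain ⟨ρ, hρ0, hρr, hρr₀, hρη⟩ : ∃ ρ, 0 < ρ ∧ ρ < r ∧ ρ < r₀ ∧ ρ < η :=
    ⟨min r (min r₀ η) / 2, by positivity,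
      by linarith [min_le_left r (min r₀ η), lt_min hr (lt_min hr₀ hη)],
      by linarith [(min_le_right r (min r₀ η)).trans (min_le_left _ _),
        lt_min hr (lt_min hr₀ hη)],
      by linarith [(min_le_right r (min r₀ η)).trans (min_le_right _ _),
        lt_min hr (lt_min hr₀ hη)]⟩
  obtain ⟨θ, hθ, hθc, hθV, hθ01, V₁, hV₁o, hKV₁, hV₁⟩ := exists_cutoff hK hVo hKV
  obtain ⟨C', hC'0, hC'⟩ := exists_norm_fderiv_le hθ hθc
  -- The second potential is chosen after `ρ` and `θ`: at most `ρ / 8`, to leave the oscillation of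
  -- `φ` at scale `ρ` visible, and small enough to absorb the gradients of both cutoffs.
  obtain ⟨ψ, hψd, hψ01, hψs, V₂, hV₂o, hKV₂, hV₂⟩ := exists_smooth_potential hK he hα0
    (by linarith) hw (η := min (min (η / 2) (ρ / 8)) (α / (C + C'))) (by positivity)
  have hφη : ∀ x, φ x ≤ η / 2 := fun x => (hφ01 x).2.trans (min_le_left _ _)
  have hφC : ∀ x, φ x * C ≤ α := fun x => by
    rw [← le_div_iff₀ hC0]; exact (hφ01 x).2.trans (min_le_right _ _)
  have hψη : ∀ x, ψ x ≤ η / 2 := fun x =>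
    (hψ01 x).2.trans ((min_le_left _ _).trans (min_le_left _ _))
  have hψρ : ∀ x, ψ x ≤ ρ / 8 := fun x =>
    (hψ01 x).2.trans ((min_le_left _ _).trans (min_le_right _ _))
  have hψC : ∀ x, ψ x * (C + C') ≤ α := fun x => by
    rw [← le_div_iff₀ (by positivity)]; exact (hψ01 x).2.trans (min_le_right _ _)
  have hθψ : ∀ x, 0 ≤ θ x * ψ x ∧ θ x * ψ x ≤ ψ x := fun x =>
    ⟨mul_nonneg (hθ01 x).1 (hψ01 x).1, mul_le_of_le_one_left (hψ01 x).1 (hθ01 x).2⟩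
  have hχd := hχ.differentiable (by simp)
  have hθd := hθ.differentiable (by simp)
  -- Near `K` both potentials have gradient about `e`, so the difference is flat. The cutoff `θ`
  -- confines `ψ` to `V`, where `φ` has gradient about `e`; the difference there has gradient about
  -- `(1 - θ x * s) • e`, with no large slope.
  set h : EuclideanSpace ℝ (Fin n) → ℝ := fun x => χ x * (φ x - θ x * ψ x) with hh
  have hd : Differentiable ℝ h := by fun_prop
  have hsupp : tsupport h ⊆ T := closure_mono fun x hx => left_ne_zero_of_mul hx
  have hout : ∀ x ∉ T, fderiv ℝ h x = 0 := fun x hx =>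
    Function.notMem_support.1 fun h' => hx (hsupp (support_fderiv_subset ℝ h'))
  have hbound : ∀ x, ‖fderiv ℝ h x‖ ≤
      ‖fderiv ℝ φ x - θ x • fderiv ℝ ψ x‖ + 2 * α := by
    intro x
    have hD : fderiv ℝ h x = χ x • (fderiv ℝ φ x - θ x • fderiv ℝ ψ x) +
        (φ x • fderiv ℝ χ x - ((θ x * ψ x) • fderiv ℝ χ x + (χ x * ψ x) • fderiv ℝ θ x)) := by
      have := ((hχd x).hasFDerivAt.mul
        ((hφd x).hasFDerivAt.sub ((hθd x).hasFDerivAt.mul (hψd x).hasFDerivAt))).fderiv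
      rw [show h = χ * (φ - θ * ψ) from rfl, this]
      simp only [Pi.sub_apply, Pi.mul_apply]
      module
    have b1 : ‖χ x • (fderiv ℝ φ x - θ x • fderiv ℝ ψ x)‖ ≤
        ‖fderiv ℝ φ x - θ x • fderiv ℝ ψ x‖ := by
      rw [norm_smul, Real.norm_eq_abs, abs_of_nonneg (hχ01 x).1]
      exact mul_le_of_le_one_left (norm_nonneg _) (hχ01 x).2
    have b2 : ‖φ x • fderiv ℝ χ x‖ ≤ α := by
      rw [norm_smul, Real.norm_eq_abs, abs_of_nonneg (hφ01 x).1]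
      exact (mul_le_mul_of_nonneg_left (hC x) (hφ01 x).1).trans (hφC x)
    have b3 : ‖(θ x * ψ x) • fderiv ℝ χ x‖ ≤ ψ x * C := by
      rw [norm_smul, Real.norm_eq_abs, abs_of_nonneg (hθψ x).1]
      exact mul_le_mul (hθψ x).2 (hC x) (norm_nonneg _) (hψ01 x).1
    have b4 : ‖(χ x * ψ x) • fderiv ℝ θ x‖ ≤ ψ x * C' := by
      rw [norm_smul, Real.norm_eq_abs, abs_of_nonneg (mul_nonneg (hχ01 x).1 (hψ01 x).1)]
      exact mul_le_mul (mul_le_of_le_one_left (hψ01 x).1 (hχ01 x).2) (hC' x) (norm_nonneg _)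
        (hψ01 x).1
    rw [hD]
    refine (norm_add_le _ _).trans (add_le_add b1 ((norm_sub_le _ _).trans ?_))
    have := norm_add_le ((θ x * ψ x) • fderiv ℝ χ x) ((χ x * ψ x) • fderiv ℝ θ x)
    linarith [hψC x, mul_add (ψ x) C C']
  have hℓ : ‖innerSL ℝ e‖ = 1 := by rw [innerSL_apply_norm, he]
  have hsℓ : ∀ s ∈ Icc (0 : ℝ) 1, ‖s • innerSL ℝ e‖ ≤ 1 := fun s hs => by
    rw [norm_smul, hℓ, mul_one, Real.norm_eq_abs, abs_of_nonneg hs.1]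
    exact hs.2
  refine ⟨h, hd, fun x => ?_, hsupp, fun x => ?_, ?_, ρ, hρ0, hρη, fun x hxF hx => ?_⟩
  · rw [hh, abs_mul, abs_of_nonneg (hχ01 x).1]
    refine (mul_le_of_le_one_left (abs_nonneg _) (hχ01 x).2).trans ?_
    rw [abs_le]
    constructor <;> linarith [hφη x, hψη x, (hφ01 x).1, hθψ x]
  · refine (hbound x).trans ?_
    by_cases hxV : x ∈ V
    · obtain ⟨s, hs, hs'⟩ := hψs x
      have h1 : fderiv ℝ φ x - θ x • fderiv ℝ ψ x = (fderiv ℝ φ x - innerSL ℝ e) -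
          θ x • (fderiv ℝ ψ x - s • innerSL ℝ e) + (1 - θ x * s) • innerSL ℝ e := by module
      have h2 : ‖θ x • (fderiv ℝ ψ x - s • innerSL ℝ e)‖ ≤ 2 * α := by
        rw [norm_smul, Real.norm_eq_abs, abs_of_nonneg (hθ01 x).1]
        exact (mul_le_of_le_one_left (norm_nonneg _) (hθ01 x).2).trans hs'
      have h3 := hsℓ (1 - θ x * s) ⟨by nlinarith [(hθ01 x).1, (hθ01 x).2, hs.1, hs.2],
        by nlinarith [(hθ01 x).1, hs.1]⟩
      rw [h1]
      have h4 := norm_add_le (fderiv ℝ φ x - innerSL ℝ e -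
          θ x • (fderiv ℝ ψ x - s • innerSL ℝ e)) ((1 - θ x * s) • innerSL ℝ e)
      have h5 := norm_sub_le (fderiv ℝ φ x - innerSL ℝ e)
          (θ x • (fderiv ℝ ψ x - s • innerSL ℝ e))
      linarith [hV x hxV]
    · have hθx : θ x = 0 := image_eq_zero_of_notMem_tsupport fun h' => hxV (hθV h')
      obtain ⟨s, hs, hs'⟩ := hφs x
      have h1 := norm_add_le (fderiv ℝ φ x - s • innerSL ℝ e) (s • innerSL ℝ e)
      rw [sub_add_cancel] at h1
      rw [hθx, zero_smul, sub_zero]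
      linarith [hsℓ s hs]
  · refine ⟨(V ∩ V₁ ∩ V₂) ∪ Tᶜ, ((hVo.inter hV₁o).inter hV₂o).union hTcl.isOpen_compl,
      fun x hx => ?_, fun x hx => ?_⟩
    · by_cases hxT : x ∈ T
      · exact Or.inl ⟨⟨hKV ⟨hx, hxT⟩, hKV₁ ⟨hx, hxT⟩⟩, hKV₂ ⟨hx, hxT⟩⟩
      · exact Or.inr hxT
    · rcases hx with ⟨⟨hx, hx₁⟩, hx₂⟩ | hx
      · refine (hbound x).trans ?_
        have h1 : fderiv ℝ φ x - (1 : ℝ) • fderiv ℝ ψ x = (fderiv ℝ φ x - innerSL ℝ e) -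
          (fderiv ℝ ψ x - innerSL ℝ e) := by module
        rw [hV₁ x hx₁, h1]
        have h5 := norm_sub_le (fderiv ℝ φ x - innerSL ℝ e) (fderiv ℝ ψ x - innerSL ℝ e)
        linarith [hV x hx, hV₂ x hx₂]
      · rw [hout x hx, norm_zero]
        positivity
  · have hxT : x ∈ T := subset_tsupport _ (by
      rw [Function.mem_support, hx x (mem_ball_self hr₀)]
      exact one_ne_zero)
    have hdist : dist (x + ρ • e) x = ρ := by
      rw [dist_eq_norm, add_sub_cancel_left, norm_smul, he, mul_one, Real.norm_eq_abs,
        abs_of_pos hρ0]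
    have hy : χ (x + ρ • e) = 1 := hx _ (by rw [mem_ball, hdist]; exact hρr₀)
    have hball : ball x r ⊆ V := fun z hz => hrV (mem_thickening_iff.2 ⟨x, ⟨hxF, hxT⟩, hz⟩)
    have hmv := (convex_ball x r).norm_image_sub_le_of_norm_fderiv_le (𝕜 := ℝ)
      (f := fun z => φ z - innerSL ℝ e z) (C := 2 * α) (x := x) (y := x + ρ • e)
      (fun z _ => by fun_prop) (fun z hz => by
        rw [fderiv_fun_sub (hφd z) (innerSL ℝ e).differentiableAt, ContinuousLinearMap.fderiv]
        exact hV z (hball hz))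
      (mem_ball_self hr) (by rw [mem_ball, hdist]; exact hρr)
    rw [← dist_eq_norm (x + ρ • e), hdist, Real.norm_eq_abs] at hmv
    have hin : innerSL ℝ e (x + ρ • e) = innerSL ℝ e x + ρ := by
      simp [inner_add_right, inner_smul_right, he]
    rw [hin] at hmv
    have h1 := (abs_le.1 hmv).1
    refine le_trans ?_ (le_abs_self _)
    simp only [hh, hy, hx x (mem_ball_self hr₀), one_mul]
    -- From `x` to `x + ρ • e`, `φ` rises by at least `2 / 3 * ρ`, and subtracting `θ * ψ` costs at
    -- most `ρ / 8`.
    have h2 : 2 * α * ρ ≤ 1 / 3 * ρ := by gcongr; linarith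
    linarith [hθψ x, hθψ (x + ρ • e), hψρ (x + ρ • e)]

end ConeUnrectifiability

/-! ### Oscillations on balls and their sum across scales. -/

namespace ConeUnrectifiability

open MeasureTheory Metric Set Filter Topology

variable {n : ℕ}

/-- A ball which meets `F` in a set of zero `(dir, prec)`-width. -/
structure NullBall (F : Set (EuclideanSpace ℝ (Fin n))) where
  center : EuclideanSpace ℝ (Fin n)
  dir : EuclideanSpace ℝ (Fin n)
  innerRadius : ℝ
  radius : ℝ
  prec : ℝ
  innerRadius_lt : innerRadius < radius
  radius_pos : 0 < radius
  norm_dir : ‖dir‖ = 1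
  prec_pos : 0 < prec
  prec_le : prec ≤ 1 / 6
  width_eq_zero : width dir prec (F ∩ closedBall center radius) = 0

theorem NullBall.exists_oscillation {F : Set (EuclideanSpace ℝ (Fin n))} (hF : IsCompact F)
    (B : NullBall F) {d : ℝ} (hd : 0 < d) :
    ∃ (h : EuclideanSpace ℝ (Fin n) → ℝ) (d' : ℝ), 0 < d' ∧ d' ≤ d / 2 ∧ Differentiable ℝ h ∧
      (∀ x, |h x| ≤ d / 200) ∧ tsupport h ⊆ closedBall B.center B.radius ∧
      tsupport h ⊆ thickening d F ∧ (∀ x, ‖fderiv ℝ h x‖ ≤ 2) ∧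
      (∀ x ∈ thickening d' F, ‖fderiv ℝ h x‖ ≤ 6 * B.prec) ∧
      ∀ x ∈ F, x ∈ ball B.center B.innerRadius →
        ∃ y, d' ≤ dist y x ∧ dist y x < d ∧ dist y x / 2 ≤ |h y - h x| := by
  obtain ⟨θ, hθ, hθc, hθd, hθ01, V, hVo, hFV, hV⟩ :=
    exists_cutoff hF (isOpen_thickening (δ := d) (E := F)) (self_subset_thickening hd F)
  obtain ⟨r₁, hr₁, hr₁V⟩ := hF.exists_thickening_subset_open hVo hFV
  -- The inner radius may be negative, whereas a bump function needs positive radii.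
  have hmax : max B.innerRadius 0 < B.radius := max_lt B.innerRadius_lt B.radius_pos
  let β : ContDiffBump B.center := ⟨(B.radius + max B.innerRadius 0) / 2, B.radius,
    by linarith [le_max_right B.innerRadius 0, B.radius_pos], by linarith⟩
  have hβts : tsupport β = closedBall B.center B.radius := β.tsupport_eq
  have hts1 : tsupport (fun x => β x * θ x) ⊆ tsupport β := tsupport_mul_subset_left
  have hts2 : tsupport (fun x => β x * θ x) ⊆ tsupport θ := tsupport_mul_subset_right
  obtain ⟨h, hh, hη, hsupp, h2, ⟨W, hWo, hFW, hW⟩, ρ, hρ0, hρη, hosc⟩ :=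
    ConeUnrectifiability.exists_oscillation hF B.norm_dir B.prec_pos B.prec_le
    (χ := fun x => β x * θ x) (β.contDiff.mul hθ) hθc.mul_left
    (fun x => ⟨mul_nonneg β.nonneg (hθ01 x).1, mul_le_one₀ β.le_one (hθ01 x).1 (hθ01 x).2⟩)
    (le_antisymm ((width_mono (inter_subset_inter_right F (hts1.trans hβts.subset))).trans
      B.width_eq_zero.le) zero_le) (η := d / 200)
    (r₀ := min r₁ ((B.radius - max B.innerRadius 0) / 2)) (by positivity)
    (lt_min hr₁ (by linarith))
  obtain ⟨r₂, hr₂, hr₂W⟩ := hF.exists_thickening_subset_open hWo hFW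
  refine ⟨h, min (d / 2) (min ρ r₂), by positivity, min_le_left _ _, hh, hη,
    hsupp.trans (hts1.trans hβts.subset), hsupp.trans (hts2.trans hθd), h2, fun x hx => ?_,
    fun x hxF hx => ?_⟩
  · exact hW x (hr₂W (thickening_mono ((min_le_right _ _).trans (min_le_right _ _)) F hx))
  · have hdist : dist (x + ρ • B.dir) x = ρ := by
      rw [dist_eq_norm, add_sub_cancel_left, norm_smul, B.norm_dir, mul_one, Real.norm_eq_abs,
        abs_of_pos hρ0]
    refine ⟨x + ρ • B.dir, ?_, ?_, ?_⟩
    · rw [hdist]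
      exact (min_le_right _ _).trans (min_le_left _ _)
    · rw [hdist]
      linarith
    · rw [hdist]
      refine hosc x hxF fun y hy => ?_
      have hy : dist y x < min r₁ ((B.radius - max B.innerRadius 0) / 2) := hy
      have hθy : θ y = 1 :=
        hV y (hr₁V (mem_thickening_iff.2 ⟨x, hxF, hy.trans_le (min_le_left _ _)⟩))
      have hβy : β y = 1 := β.one_of_mem_closedBall (by
        rw [mem_closedBall]
        have h1 := dist_triangle y x B.center
        have h2 := min_le_right r₁ ((B.radius - max B.innerRadius 0) / 2)
        have h3 : dist x B.center < B.innerRadius := hx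
        have h4 : β.rIn = (B.radius + max B.innerRadius 0) / 2 := rfl
        linarith [le_max_left B.innerRadius 0])
      simp only [hθy, hβy, mul_one]

/-- `f` is nearly constant on some small balls around `x`, and not at all nearly constant on
others. -/
structure OscillatesAt {X : Type*} [PseudoMetricSpace X] (f : X → ℝ) (x : X) : Prop where
  flat : ∀ r > 0, ∃ ρ, 0 < ρ ∧ ρ < r ∧ ∀ z, dist z x ≤ ρ → |f z - f x| ≤ ρ / 16
  steep : ∀ r > 0, ∃ y, 0 < dist y x ∧ dist y x < r ∧ dist y x / 4 ≤ |f y - f x|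

/-- Summing small functions which are chosen one after the other, each at the scale left by the
previous one. -/
theorem exists_oscillatesAt_of_steps {X : Type*} [NormedAddCommGroup X] [NormedSpace ℝ X]
    {F : Set X} (hF : IsClosed F) {T P : ℕ → Set X} {b : ℕ → ℝ}
    (hb : ∀ x M, ∑ m ∈ Finset.range M, (T m).indicator (fun _ => b m) x ≤ 1 / 100)
    (hP : ∀ x ∈ F, ∃ᶠ m in atTop, x ∈ P m)
    (step : ∀ m, ∀ d > 0, ∃ (h : X → ℝ) (d' : ℝ), 0 < d' ∧ d' ≤ d / 2 ∧ Differentiable ℝ h ∧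
      (∀ x, |h x| ≤ d / 200) ∧ tsupport h ⊆ T m ∧
      tsupport h ⊆ thickening d F ∧ (∀ x, ‖fderiv ℝ h x‖ ≤ 2) ∧
      (∀ x ∈ thickening d' F, ‖fderiv ℝ h x‖ ≤ b m) ∧
      ∀ x ∈ F, x ∈ P m → ∃ y, d' ≤ dist y x ∧ dist y x < d ∧ dist y x / 2 ≤ |h y - h x|) :
    ∃ f : X → ℝ, LipschitzWith 3 f ∧ (∀ x, |f x| ≤ 1) ∧ (∀ x ∉ F, DifferentiableAt ℝ f x) ∧
      ∀ x ∈ F, OscillatesAt f x := by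
  choose! h d' hd'0 hd'2 hdiff habs hT hthick h2 hflat hsteep using step
  -- `D m` is the scale given to step `m`; the scale that step returns is given to the next.
  let D : ℕ → ℝ := fun m => Nat.rec 1 (fun m d => d' m d) m
  have hDs : ∀ m, D (m + 1) = d' m (D m) := fun m => rfl
  have hD0 : ∀ m, 0 < D m := fun m => by
    induction m with
    | zero => exact one_pos
    | succ m ih => exact hd'0 m _ ih
  have hDhalf : ∀ m, D (m + 1) ≤ D m / 2 := fun m => hd'2 m _ (hD0 m)
  have hDpow : ∀ M k, D (k + M) ≤ D M / 2 ^ k := by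
    intro M k
    induction k with
    | zero => simp
    | succ k ih =>
      rw [add_right_comm, pow_succ, ← div_div]
      exact (hDhalf _).trans (by linarith)
  have hDanti : Antitone D := antitone_nat_of_succ_le fun m => by linarith [hDhalf m, hD0 m]
  have hDlim : Tendsto D atTop (𝓝 0) := by
    refine squeeze_zero (fun m => (hD0 m).le) (fun m => hDpow 0 m) ?_
    have := tendsto_pow_atTop_nhds_zero_of_lt_one (r := (1 / 2 : ℝ)) (by norm_num) (by norm_num)
    refine (this.const_mul (D 0)).congr' ?_ |>.trans (by simp)
    exact Eventually.of_forall fun k => by simp [div_eq_mul_inv]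
  set H : ℕ → X → ℝ := fun m => h m (D m) with hH
  have hHd : ∀ m, Differentiable ℝ (H m) := fun m => hdiff m _ (hD0 m)
  have hHabs : ∀ M k x, ‖H (k + M) x‖ ≤ D M / 100 / 2 / 2 ^ k := by
    intro M k x
    have h1 := habs (k + M) _ (hD0 (k + M)) x
    have h2 := hDpow M k
    rw [Real.norm_eq_abs]
    calc |H (k + M) x| ≤ D (k + M) / 200 := h1
      _ ≤ D M / 2 ^ k / 200 := by gcongr
      _ = D M / 100 / 2 / 2 ^ k := by ring
  have hsum : ∀ x, Summable fun m => H m x := fun x =>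
    Summable.of_norm_bounded (hasSum_geometric_two' (D 0 / 100)).summable (hHabs 0 · x)
  set f : X → ℝ := fun x => ∑' m, H m x with hf
  set S : ℕ → X → ℝ := fun M x => ∑ m ∈ Finset.range M, H m x with hS
  have htail : ∀ M x, |f x - S M x| ≤ D M / 100 := by
    intro M x
    have h1 : f x - S M x = ∑' k, H (k + M) x := by
      simp only [hf, hS]
      rw [← (hsum x).sum_add_tsum_nat_add M]
      ring
    rw [h1, ← Real.norm_eq_abs]
    exact tsum_of_norm_bounded (hasSum_geometric_two' (D M / 100)) (hHabs M · x)
  have hSd : ∀ M, Differentiable ℝ (S M) := fun M =>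
    Differentiable.fun_sum fun m _ => hHd m
  have hSs : ∀ M, S (M + 1) = fun x => S M x + H M x := fun M => by
    funext x
    simp only [hS, Finset.sum_range_succ]
  have hfd0 : ∀ m x, x ∉ tsupport (H m) → fderiv ℝ (H m) x = 0 := fun m x hx =>
    Function.notMem_support.1 fun h' => hx (support_fderiv_subset ℝ h')
  -- Each earlier term is flat on the `D (m + 1)`-thickening, which contains the `D M`-thickening,
  -- so the bounds `b m` add up.
  have hSflat : ∀ M x, x ∈ thickening (D M) F → ‖fderiv ℝ (S M) x‖ ≤ 1 / 100 := by
    intro M x hx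
    refine le_trans ?_ (hb x M)
    rw [hS, fderiv_fun_sum fun m _ => (hHd m) x]
    refine norm_sum_le_of_le _ fun m hm => ?_
    by_cases hxT : x ∈ T m
    · rw [indicator_of_mem hxT]
      exact hflat m _ (hD0 m) x
        (thickening_mono (hDs m ▸ hDanti (Finset.mem_range.1 hm)) F hx)
    · rw [indicator_of_notMem hxT, hfd0 m x fun h' => hxT (hT m _ (hD0 m) h'), norm_zero]
  -- Slopes do not accumulate: the new term lives where the previous sum has slope at most `1 /
  -- 100`, and elsewhere it changes nothing.
  have hS3 : ∀ M x, ‖fderiv ℝ (S M) x‖ ≤ 3 := by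
    intro M
    induction M with
    | zero => intro x; simp [hS]
    | succ M ih =>
      intro x
      rw [hSs, fderiv_fun_add (hSd M x) (hHd M x)]
      by_cases hx : x ∈ thickening (D M) F
      · have h1 := norm_add_le (fderiv ℝ (S M) x) (fderiv ℝ (H M) x)
        linarith [hSflat M x hx, h2 M _ (hD0 M) x]
      · rw [hfd0 M x fun h' => hx (hthick M _ (hD0 M) h'), add_zero]
        exact ih x
  have hSlip : ∀ M, LipschitzWith 3 (S M) := fun M =>
    lipschitzWith_of_nnnorm_fderiv_le (hSd M) fun x => by exact_mod_cast hS3 M x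
  have hSloc : ∀ M, ∀ x ∈ F, ∀ z, dist z x < D M → |S M z - S M x| ≤ 1 / 100 * dist z x := by
    intro M x hx z hz
    have := (convex_ball x (D M)).norm_image_sub_le_of_norm_fderiv_le (𝕜 := ℝ)
      (f := S M) (C := 1 / 100) (x := x) (y := z) (fun z _ => hSd M z)
      (fun y hy => hSflat M y (mem_thickening_iff.2 ⟨x, hx, hy⟩)) (mem_ball_self (hD0 M)) hz
    rwa [Real.norm_eq_abs, ← dist_eq_norm] at this
  refine ⟨f, ?_, fun x => ?_, fun x hx => ?_, fun x hx => ⟨fun r hr => ?_, fun r hr => ?_⟩⟩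
  · refine LipschitzWith.of_dist_le_mul fun x y => ?_
    refine le_of_forall_pos_le_add fun δ hδ => ?_
    obtain ⟨M, hM⟩ := (hDlim.eventually (gt_mem_nhds hδ)).exists
    have h1 := (hSlip M).dist_le_mul x y
    rw [Real.dist_eq] at h1 ⊢
    have h3 := abs_le.1 (htail M x)
    have h4 := abs_le.1 (htail M y)
    have h5 := abs_le.1 h1
    rw [abs_le]
    have := hD0 M
    constructor <;> linarith [h3.1, h3.2, h4.1, h4.2, h5.1, h5.2]
  · have := htail 0 x
    simp only [hS, Finset.range_zero, Finset.sum_empty, sub_zero] at this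
    refine this.trans ?_
    have : D 0 = 1 := rfl
    rw [this]; norm_num
  · have hpos : 0 < infDist x F ∨ F = ∅ := by
      rcases F.eq_empty_or_nonempty with h | h
      · exact Or.inr h
      · exact Or.inl ((hF.notMem_iff_infDist_pos h).1 hx)
    obtain ⟨M, hM⟩ : ∃ M, ∀ᶠ z in 𝓝 x, z ∉ thickening (D M) F := by
      rcases hpos with h | h
      · obtain ⟨M, hM⟩ := (hDlim.eventually (gt_mem_nhds h)).exists
        refine ⟨M, ?_⟩
        filter_upwards [(continuous_infDist_pt F).continuousAt.eventually (lt_mem_nhds hM)]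
          with z hz hz'
        obtain ⟨y, hy, hzy⟩ := mem_thickening_iff.1 hz'
        linarith [infDist_le_dist_of_mem (x := z) hy]
      · exact ⟨0, by simp [h]⟩
    refine (hSd M x).congr_of_eventuallyEq ?_
    filter_upwards [hM] with z hz
    rw [hf, hS]
    refine tsum_eq_sum fun m hm => ?_
    refine image_eq_zero_of_notMem_tsupport fun h' => hz ?_
    exact thickening_mono (hDanti (by simpa using hm)) F (hthick m _ (hD0 m) h')
  · obtain ⟨M, hM⟩ := (hDlim.eventually (gt_mem_nhds hr)).exists
    -- At radius `D M / 2` the partial sum varies by at most `D M / 200` and the tails contribute at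
    -- most `2 * D M / 100`, together below `D M / 32`.
    refine ⟨D M / 2, half_pos (hD0 M), by linarith [hD0 M], fun z hz => ?_⟩
    have h1 := abs_le.1 (hSloc M x hx z (by linarith [hD0 M]))
    have h3 := abs_le.1 (htail M x)
    have h4 := abs_le.1 (htail M z)
    have := hD0 M
    rw [abs_le]
    constructor <;> linarith [h3.1, h3.2, h4.1, h4.2, h1.1, h1.2]
  · obtain ⟨M, hxM, hM⟩ := ((hP x hx).and_eventually (hDlim.eventually (gt_mem_nhds hr))).exists
    obtain ⟨y, hy1, hy2, hy3⟩ := hsteep M _ (hD0 M) x hx hxM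
    refine ⟨y, (hd'0 M _ (hD0 M)).trans_le hy1, hy2.trans hM, ?_⟩
    have h1 := hSloc M x hx y hy2
    have h3 := htail (M + 1) x
    have h4 := htail (M + 1) y
    rw [hDs] at h3 h4
    simp only [hSs] at h3 h4
    -- Later terms are controlled by `D (M + 1) ≤ dist y x`, so they and the flat earlier sum remove
    -- at most `3 / 100` of the distance from the oscillation.
    have h5 : H M y - H M x = (f y - f x) - (f y - (S M y + H M y)) + (f x - (S M x + H M x)) -
      (S M y - S M x) := by ring
    have h6 : |H M y - H M x| ≤ |f y - f x| + |f y - (S M y + H M y)| +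
        |f x - (S M x + H M x)| + |S M y - S M x| := by
      rw [h5]
      exact (abs_sub _ _).trans (add_le_add_left ((abs_add_le _ _).trans
        (add_le_add_left (abs_sub _ _) _)) _)
    have h7 : dist y x / 2 ≤ |H M y - H M x| := hy3
    linarith [dist_nonneg (x := y) (y := x)]

end ConeUnrectifiability

/-! ### Besicovitch covers by null balls. -/

namespace ConeUnrectifiability

open MeasureTheory Metric Set Filter Topology

variable {n : ℕ}

/-- Widths are monotone, so shrinking the set only enlarges the normals, and zero is always a
normal. -/
lemma ConeUnrectifiable.mono {E F : Set (EuclideanSpace ℝ (Fin n))} (hE : ConeUnrectifiable E)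
    (h : F ⊆ E) : ConeUnrectifiable F := by
  intro x hx hF
  refine hE x (h hx) (Subset.antisymm (fun e he => ?_) ?_)
  · rw [← hF]
    intro ε hε
    obtain ⟨r, hr, hw⟩ := he ε hε
    exact ⟨r, hr, le_antisymm
      ((width_mono (inter_subset_inter_right _ h)).trans hw.le) zero_le⟩
  · rintro _ rfl ε hε
    exact ⟨1, one_pos, by simp [width]⟩

lemma ConeUnrectifiable.exists_unit_normal {F : Set (EuclideanSpace ℝ (Fin n))}
    (hF : ConeUnrectifiable F) {x : EuclideanSpace ℝ (Fin n)} (hx : x ∈ F) :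
    ∃ e, ‖e‖ = 1 ∧ e ∈ normals F x := by
  obtain ⟨e, he, he0⟩ : ∃ e ∈ normals F x, e ≠ 0 := by
    by_contra! h
    refine hF x hx (Subset.antisymm h ?_)
    rintro _ rfl ε hε
    exact ⟨1, one_pos, by simp [width]⟩
  have hpos : 0 < ‖e‖⁻¹ := inv_pos.2 (norm_pos_iff.2 he0)
  refine ⟨‖e‖⁻¹ • e, norm_smul_inv_norm he0, fun ε hε => ?_⟩
  obtain ⟨r, hr, hw⟩ := he ε hε
  exact ⟨r, hr, by rw [width_smul hpos, hw]⟩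

/-- Finite covers by null balls, which split into a bounded number of disjoint families. -/
theorem exists_finite_nullBalls {F : Set (EuclideanSpace ℝ (Fin n))} (hF : IsCompact F)
    (hFc : ConeUnrectifiable F) : ∃ N : ℕ, ∀ ε : ℝ, 0 < ε → ε ≤ 1 / 6 →
      ∃ (ι : Type) (_ : Finite ι) (B : ι → NullBall F) (color : ι → Fin N),
        (∀ i, (B i).prec = ε) ∧
        (∀ i j x, color i = color j → x ∈ closedBall (B i).center (B i).radius →
          x ∈ closedBall (B j).center (B j).radius → i = j) ∧
        F ⊆ ⋃ i, ball (B i).center (B i).innerRadius := by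
  -- The Besicovitch number is fixed before `ε`, so the number of colors does not depend on the
  -- precision.
  obtain ⟨N, τ, hτ, hN⟩ :=
    HasBesicovitchCovering.no_satelliteConfig (α := EuclideanSpace ℝ (Fin n))
  refine ⟨N, fun ε hε hε6 => ?_⟩
  have hx : ∀ x : F, ∃ e r, ‖e‖ = 1 ∧ 0 < r ∧ r ≤ 1 ∧
      width e ε (F ∩ closedBall (x : EuclideanSpace ℝ (Fin n)) r) = 0 := by
    intro x
    obtain ⟨e, he, hen⟩ := hFc.exists_unit_normal x.2
    obtain ⟨r, hr, hw⟩ := hen ε hε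
    refine ⟨e, min (r / 2) 1, he, by positivity, min_le_right _ _, le_antisymm ?_ zero_le⟩
    rw [← hw, inter_comm]
    exact width_mono (inter_subset_inter_left _ ((closedBall_subset_closedBall
      (min_le_left _ _)).trans (closedBall_subset_ball (by linarith))))
  choose e r he hr hr1 hw using hx
  obtain ⟨s, hs, hcov⟩ := Besicovitch.exist_disjoint_covering_families hτ hN
    (⟨Subtype.val, r, hr, 1, hr1⟩ : Besicovitch.BallPackage F (EuclideanSpace ℝ (Fin n)))
  simp only [Subtype.range_coe] at hcov hs
  obtain ⟨t, hts, htfin, htF⟩ := hF.elim_finite_subcover_image (b := ⋃ i, s i)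
    (c := fun j : F => ball (j : EuclideanSpace ℝ (Fin n)) (r j)) (fun _ _ => isOpen_ball)
    (hcov.trans (by
      intro y hy
      simp only [mem_iUnion] at hy ⊢
      obtain ⟨i, j, hj, hy⟩ := hy
      exact ⟨j, ⟨i, hj⟩, hy⟩))
  have : Finite t := htfin
  obtain ⟨r', hr'F, hr'⟩ := exists_subset_iUnion_ball_radius_lt (ι := t)
    (c := fun j => ((j : F) : EuclideanSpace ℝ (Fin n))) (r := fun j => r j) hF.isClosed
    (fun _ _ => Set.toFinite _) (by simpa only [iUnion_coe_set] using htF)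
  have hcol : ∀ j : t, ∃ i, (j : F) ∈ s i := fun j => by simpa using hts j.2
  choose color hcolor using hcol
  refine ⟨t, this, fun j => ⟨j, e j, r' j, r j, ε, hr' j, hr j, he j, hε, hε6, hw j⟩, color,
    fun _ => rfl, fun i j x hij hi hj => ?_, hr'F⟩
  by_contra hne
  refine disjoint_left.1 (hs (color i) (hcolor i) (hij ▸ hcolor j) ?_) hi hj
  exact fun h => hne (Subtype.ext h)

/-- A sequence of null balls, with summable precisions along the balls that contain a given
point. -/
theorem exists_seq_nullBalls {F : Set (EuclideanSpace ℝ (Fin n))} (hF : IsCompact F)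
    (hFc : ConeUnrectifiable F) (hne : F.Nonempty) :
    ∃ B : ℕ → NullBall F,
      (∀ x M, ∑ m ∈ Finset.range M, (closedBall (B m).center (B m).radius).indicator
        (fun _ => 6 * (B m).prec) x ≤ 1 / 100) ∧
      ∀ x ∈ F, ∃ᶠ m in atTop, x ∈ ball (B m).center (B m).innerRadius := by
  obtain ⟨N, hN⟩ := exists_finite_nullBalls hF hFc
  -- Level `k` has precision `ε₀ / 2 ^ k`, and at most `N` of its balls contain a given point. The
  -- total is at most `12 * N * ε₀ ≤ 1 / 100`.
  set ε₀ : ℝ := 1 / (1200 * (N + 1)) with hε₀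
  have hε₀0 : 0 < ε₀ := by positivity
  have hε₀1 : ε₀ ≤ 1 / 6 := by
    rw [hε₀]
    gcongr
    have : (0 : ℝ) ≤ N := N.cast_nonneg
    linarith
  have hε₀N : N * (6 * ε₀) * 2 ≤ 1 / 100 := by
    have : N * (6 * ε₀) * 2 = 1 / 100 * (N / (N + 1)) := by rw [hε₀]; field_simp; ring
    rw [this]
    have : (N : ℝ) / (N + 1) ≤ 1 := by rw [div_le_one (by positivity)]; linarith
    linarith
  have hk (k : ℕ) := hN (ε₀ * (1 / 2) ^ k) (by positivity)
    ((mul_le_of_le_one_right hε₀0.le (pow_le_one₀ (by norm_num) (by norm_num))).trans hε₀1)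
  choose ι hfin B color hprec hcolor hcov using hk
  have hex : ∀ x ∈ F, ∀ k, ∃ i, x ∈ ball (B k i).center (B k i).innerRadius := fun x hx k =>
    mem_iUnion.1 (hcov k hx)
  have hinf : Infinite (Σ k, ι k) := by
    obtain ⟨x, hx⟩ := hne
    choose i _ using hex x hx
    exact Infinite.of_injective (fun k => (⟨k, i k⟩ : Σ k, ι k)) fun a b hab =>
      congrArg Sigma.fst hab
  obtain ⟨hden⟩ := nonempty_denumerable (Σ k, ι k)
  let g : ℕ ≃ (Σ k, ι k) := (Denumerable.eqv _).symm
  refine ⟨fun m => B (g m).1 (g m).2, fun x M => ?_, fun x hx => ?_⟩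
  · classical
    set A := (Finset.range M).filter fun m =>
      x ∈ closedBall (B (g m).1 (g m).2).center (B (g m).1 (g m).2).radius with hA
    set p : ℕ → ℕ × Fin N := fun m => ((g m).1, color _ (g m).2) with hp
    -- Balls of one level and color are disjoint, so level and color determine a ball through `x`.
    have hinj : Set.InjOn p A := by
      intro a ha b hb hab
      have ha := (Finset.mem_filter.1 ha).2
      have hb := (Finset.mem_filter.1 hb).2
      apply g.injective
      simp only [hp] at hab
      generalize g a = u at *
      generalize g b = v at *
      obtain ⟨k, i⟩ := u
      obtain ⟨l, j⟩ := v
      obtain ⟨rfl, hc⟩ := Prod.mk.inj hab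
      rw [hcolor k i j x hc ha hb]
    obtain ⟨K, hK⟩ := Finset.exists_nat_subset_range ((A.image p).image Prod.fst)
    calc _ = ∑ m ∈ A, 6 * (ε₀ * (1 / 2) ^ (p m).1) := by
          rw [hA, Finset.sum_filter]
          refine Finset.sum_congr rfl fun m _ => ?_
          simp only [indicator_apply, hprec, hp]
      _ = ∑ q ∈ A.image p, 6 * (ε₀ * (1 / 2) ^ q.1) :=
          (Finset.sum_image (f := fun q : ℕ × Fin N => 6 * (ε₀ * (1 / 2) ^ q.1)) hinj).symm
      _ ≤ ∑ q ∈ Finset.range K ×ˢ (Finset.univ : Finset (Fin N)),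
            6 * (ε₀ * (1 / 2) ^ q.1) := by
          refine Finset.sum_le_sum_of_subset_of_nonneg (fun q hq => ?_)
            fun _ _ _ => by positivity
          exact Finset.mem_product.2 ⟨hK (Finset.mem_image_of_mem _ hq), Finset.mem_univ _⟩
      _ = N * (6 * ε₀) * ∑ k ∈ Finset.range K, (1 / 2 : ℝ) ^ k := by
          rw [Finset.sum_product, Finset.mul_sum]
          refine Finset.sum_congr rfl fun k _ => ?_
          simp only [Finset.sum_const, Finset.card_univ, Fintype.card_fin, nsmul_eq_mul]
          ring
      _ ≤ N * (6 * ε₀) * 2 := by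
          gcongr
          exact sum_geometric_two_le K
      _ ≤ 1 / 100 := hε₀N
  · choose i hi using hex x hx
    rw [Nat.frequently_atTop_iff_infinite]
    refine Set.infinite_of_injective_forall_mem (f := fun k => g.symm ⟨k, i k⟩)
      (fun a b hab => congrArg Sigma.fst (g.symm.injective hab)) fun k => ?_
    change x ∈ (fun u : Σ k, ι k => ball (B u.1 u.2).center (B u.1 u.2).innerRadius)
      (g (g.symm ⟨k, i k⟩))
    rw [g.apply_symm_apply]
    exact hi k

theorem exists_oscillatesAt_of_isCompact {F : Set (EuclideanSpace ℝ (Fin n))} (hF : IsCompact F)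
    (hFc : ConeUnrectifiable F) :
    ∃ f : EuclideanSpace ℝ (Fin n) → ℝ, LipschitzWith 3 f ∧ (∀ x, |f x| ≤ 1) ∧
      (∀ x ∉ F, DifferentiableAt ℝ f x) ∧ ∀ x ∈ F, OscillatesAt f x := by
  rcases F.eq_empty_or_nonempty with rfl | hne
  · exact ⟨0, LipschitzWith.const' 0, by simp, fun x _ => differentiableAt_const 0, by simp⟩
  · obtain ⟨B, hB, hfreq⟩ := exists_seq_nullBalls hF hFc hne
    exact exists_oscillatesAt_of_steps hF.isClosed hB hfreq
      fun m d hd => (B m).exists_oscillation hF hd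

end ConeUnrectifiability

/-! ### Non-differentiability from oscillation, and weighted sums. -/

namespace ConeUnrectifiability

open Metric Set Filter Topology

section Sum

variable {X : Type*} [NormedAddCommGroup X] [NormedSpace ℝ X]

/-- By linearity, flatness at a single small radius bounds a derivative in all directions by `1 /
10`, which contradicts steepness `1 / 4`. The margin tolerates the perturbation `q`. -/
lemma OscillatesAt.not_differentiableAt_add {f q : X → ℝ} {x : X} (hf : OscillatesAt f x)
    (hq : ∀ z, |q z - q x| ≤ 1 / 100 * ‖z - x‖) :
    ¬ DifferentiableAt ℝ (fun z => f z + q z) x := by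
  intro hd
  set L := fderiv ℝ (fun z => f z + q z) x
  have hlo := hd.hasFDerivAt.isLittleO.def (show (0 : ℝ) < 1 / 100 by norm_num)
  obtain ⟨r, hr, hball⟩ := Metric.eventually_nhds_iff.1 hlo
  have hL : ∀ z, dist z x < r → |f z - f x - L (z - x)| ≤ 1 / 50 * dist z x := by
    intro z hz
    have h1 := hball hz
    simp only [Real.norm_eq_abs] at h1
    have h2 := abs_le.1 h1
    have h3 := abs_le.1 (hq z)
    rw [dist_eq_norm, abs_le]
    constructor <;> linarith [h2.1, h2.2, h3.1, h3.2]
  obtain ⟨ρ, hρ0, hρr, hρ⟩ := hf.flat r hr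
  obtain ⟨y, hy0, hyr, hy⟩ := hf.steep r hr
  have hLy : |L (y - x)| ≤ 1 / 10 * dist y x := by
    have hdist : dist (x + (ρ / dist y x) • (y - x)) x = ρ := by
      rw [dist_eq_norm, add_sub_cancel_left, norm_smul, ← dist_eq_norm, Real.norm_eq_abs,
        abs_of_pos (by positivity)]
      field_simp
    have h1 := abs_le.1 (hL (x + (ρ / dist y x) • (y - x)) (by rw [hdist]; exact hρr))
    have h2 := abs_le.1 (hρ (x + (ρ / dist y x) • (y - x)) hdist.le)
    rw [hdist, add_sub_cancel_left, map_smul, smul_eq_mul] at h1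
    have h3 : |ρ / dist y x * L (y - x)| ≤ 1 / 10 * ρ := by
      rw [abs_le]
      constructor <;> linarith [h1.1, h1.2, h2.1, h2.2]
    rw [abs_mul, abs_of_pos (by positivity), div_mul_eq_mul_div, div_le_iff₀ hy0] at h3
    nlinarith
  have h1 := hL y hyr
  have h2 : |f y - f x| ≤ |f y - f x - L (y - x)| + |L (y - x)| := by
    simpa using abs_add_le (f y - f x - L (y - x)) (L (y - x))
  linarith

lemma hasFDerivAt_of_forall_approx {f : X → ℝ} {L : X →L[ℝ] ℝ} {x : X}
    (h : ∀ δ > 0, ∃ (g : X → ℝ) (L' : X →L[ℝ] ℝ), HasFDerivAt g L' x ∧ ‖L - L'‖ ≤ δ ∧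
      ∀ z, |(f z - g z) - (f x - g x)| ≤ δ * ‖z - x‖) : HasFDerivAt f L x := by
  refine .of_isLittleO (Asymptotics.isLittleO_iff.2 fun c hc => ?_)
  obtain ⟨g, L', hg, hL, hfg⟩ := h (c / 3) (by positivity)
  filter_upwards [hg.isLittleO.def (show (0 : ℝ) < c / 3 by positivity)] with z hz
  have h1 : f z - f x - L (z - x) = ((f z - g z) - (f x - g x)) + (g z - g x - L' (z - x)) -
      (L - L') (z - x) := by
    rw [sub_apply]; ring
  have h2 : ‖(L - L') (z - x)‖ ≤ c / 3 * ‖z - x‖ :=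
    ((L - L').le_opNorm _).trans (by gcongr)
  rw [h1]
  refine (norm_sub_le _ _).trans ?_
  have h3 := norm_add_le ((f z - g z) - (f x - g x)) (g z - g x - L' (z - x))
  have h4 := hfg z
  rw [← Real.norm_eq_abs] at h4
  linarith

theorem exists_lipschitz_of_oscillatesAt {F : ℕ → Set X} {f : ℕ → X → ℝ}
    (hlip : ∀ k, LipschitzWith 3 (f k)) (hbd : ∀ k x, |f k x| ≤ 1)
    (hd : ∀ k, ∀ x ∉ F k, DifferentiableAt ℝ (f k) x) (hosc : ∀ k, ∀ x ∈ F k, OscillatesAt (f k) x) :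
    ∃ g : X → ℝ, (∃ K : ℝ≥0, LipschitzWith K g) ∧ (∀ x ∈ ⋃ k, F k, ¬ DifferentiableAt ℝ g x) ∧
      ∀ x ∉ ⋃ k, F k, DifferentiableAt ℝ g x := by
  -- The tail after index `k`, divided by `c ^ k`, has Lipschitz constant at most `4 * c`, below the
  -- tolerance `1 / 100` for a perturbation.
  set c : ℝ := 1 / 1000 with hc
  have hc0 : 0 < c := by norm_num [hc]
  have hc1 : c < 1 := by norm_num [hc]
  have hgeom : ∀ a M, HasSum (fun k => a * c ^ (k + M)) (a * c ^ M * (1000 / 999)) := by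
    intro a M
    have := (hasSum_geometric_of_lt_one hc0.le hc1).mul_left (a * c ^ M)
    have h1 : (1 - c)⁻¹ = 1000 / 999 := by norm_num [hc]
    have h2 : (fun k => a * c ^ (k + M)) = fun k => a * c ^ M * c ^ k := by
      funext k
      rw [pow_add]
      ring
    rw [h2, ← h1]
    exact this
  have hsum : ∀ x, Summable fun k => c ^ k * f k x := fun x => by
    refine Summable.of_norm_bounded (hgeom 1 0).summable fun k => ?_
    rw [norm_mul, Real.norm_eq_abs, Real.norm_eq_abs, abs_of_pos (pow_pos hc0 k), one_mul]
    exact mul_le_of_le_one_right (pow_nonneg hc0.le k) (hbd k x)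
  set g : X → ℝ := fun x => ∑' k, c ^ k * f k x with hg
  set S : ℕ → X → ℝ := fun M x => ∑ k ∈ Finset.range M, c ^ k * f k x with hS
  have htail : ∀ M z x, |(g z - S M z) - (g x - S M x)| ≤ 4 * c ^ M * ‖z - x‖ := by
    intro M z x
    have h1 : ∀ x, g x - S M x = ∑' k, c ^ (k + M) * f (k + M) x := fun x => by
      simp only [hg, hS]
      rw [← (hsum x).sum_add_tsum_nat_add M]
      ring
    rw [h1, h1, ← ((summable_nat_add_iff M).2 (hsum z)).tsum_sub
      ((summable_nat_add_iff M).2 (hsum x)), ← Real.norm_eq_abs]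
    refine (tsum_of_norm_bounded (hgeom (3 * ‖z - x‖) M) fun k => ?_).trans ?_
    · rw [← mul_sub, norm_mul, Real.norm_eq_abs, abs_of_pos (pow_pos hc0 _), mul_comm]
      have := (hlip (k + M)).dist_le_mul z x
      rw [dist_eq_norm, dist_eq_norm] at this
      exact mul_le_mul_of_nonneg_right this (pow_nonneg hc0.le _)
    · have : 0 ≤ c ^ M * ‖z - x‖ := by positivity
      nlinarith
  have hSd : ∀ M x, (∀ k < M, x ∉ F k) → DifferentiableAt ℝ (S M) x := fun M x hx =>
    DifferentiableAt.fun_sum fun k hk => (hd k x (hx k (Finset.mem_range.1 hk))).const_mul _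
  refine ⟨g, ⟨4, LipschitzWith.of_dist_le_mul fun z x => ?_⟩, fun x hx hgx => ?_, fun x hx => ?_⟩
  · have := htail 0 z x
    simp only [hS, Finset.range_zero, Finset.sum_empty, sub_zero, pow_zero, mul_one] at this
    rw [Real.dist_eq, dist_eq_norm]
    exact this
  · classical
    have hx' := mem_iUnion.1 hx
    -- At the least index the earlier terms are differentiable at `x`; removing them and dividing by
    -- `c ^ k` leaves `f k` plus a small perturbation.
    set k := Nat.find hx' with hk
    have hxk : x ∈ F k := Nat.find_spec hx'
    have hSx : DifferentiableAt ℝ (S k) x := hSd k x fun j hj => Nat.find_min hx' hj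
    refine (hosc k x hxk).not_differentiableAt_add
      (q := fun z => (c ^ k)⁻¹ * (g z - S (k + 1) z)) (fun z => ?_) ?_
    · rw [← mul_sub, abs_mul, abs_of_pos (by positivity), inv_mul_le_iff₀ (by positivity)]
      refine (htail (k + 1) z x).trans ?_
      have : 0 ≤ c ^ k * ‖z - x‖ := by positivity
      rw [pow_succ, hc] at *
      nlinarith
    · refine ((hgx.sub hSx).const_mul (c ^ k)⁻¹).congr_of_eventuallyEq
        (Eventually.of_forall fun z => ?_)
      have : c ^ k ≠ 0 := (pow_pos hc0 k).ne'
      simp only [hS, Finset.sum_range_succ, Pi.sub_apply]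
      field_simp
      ring
  · have hxk : ∀ k, x ∉ F k := fun k hk => hx (mem_iUnion.2 ⟨k, hk⟩)
    have hn : ∀ k, ‖c ^ k • fderiv ℝ (f k) x‖ ≤ 3 * c ^ k := fun k => by
      rw [norm_smul, Real.norm_eq_abs, abs_of_pos (pow_pos hc0 k), mul_comm]
      exact mul_le_mul_of_nonneg_right (norm_fderiv_le_of_lipschitz ℝ (hlip k))
        (pow_nonneg hc0.le _)
    have hLs : Summable fun k => c ^ k • fderiv ℝ (f k) x :=
      Summable.of_norm_bounded (hgeom 3 0).summable hn
    -- Differentiability passes to the sum because the remainders have Lipschitz constants tending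
    -- to zero.
    refine (hasFDerivAt_of_forall_approx (L := ∑' k, c ^ k • fderiv ℝ (f k) x)
      fun δ hδ => ?_).differentiableAt
    have hlim : Tendsto (fun M => 4 * c ^ M) atTop (𝓝 0) := by
      simpa using (tendsto_pow_atTop_nhds_zero_of_lt_one hc0.le hc1).const_mul 4
    obtain ⟨M, hM⟩ := (hlim.eventually (gt_mem_nhds hδ)).exists
    refine ⟨S M, ∑ k ∈ Finset.range M, c ^ k • fderiv ℝ (f k) x, ?_, ?_, fun z => ?_⟩
    · exact HasFDerivAt.fun_sum fun k _ => ((hd k x (hxk k)).hasFDerivAt.const_mul (c ^ k))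
    · rw [← hLs.sum_add_tsum_nat_add M, add_sub_cancel_left]
      refine (tsum_of_norm_bounded (hgeom 3 M) fun k => hn (k + M)).trans ?_
      have : 0 < c ^ M := by positivity
      linarith
    · exact (htail M z x).trans (by gcongr)

end Sum

end ConeUnrectifiability

theorem mainTheorem5 {n : ℕ} {ι : Type*} [Countable ι]
    (E : Set (EuclideanSpace ℝ (Fin n))) (S : ι → Set (EuclideanSpace ℝ (Fin n)))
    (hcone : ∀ i, ConeUnrectifiability.ConeUnrectifiable (S i))
    (hF : ∀ i, ConeUnrectifiability.IsFSigma (S i))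
    (hE : E = ⋃ i, S i) :
    ∃ f : EuclideanSpace ℝ (Fin n) → ℝ,
      (∃ K : ℝ≥0, LipschitzWith K f) ∧
      (∀ x ∈ E, ¬ DifferentiableAt ℝ f x) ∧
      (∀ x ∉ E, DifferentiableAt ℝ f x) := by
  rcases isEmpty_or_nonempty ι with hι | hι
  · refine ⟨0, ⟨0, LipschitzWith.const' 0⟩, fun x hx => ?_, fun x _ => differentiableAt_const 0⟩
    simp [hE] at hx
  choose C hC hSC using hF
  -- Closed pieces cut by balls are compact, and as subsets of `S i` they stay cone unrectifiable.
  let D : ι × ℕ × ℕ → Set (EuclideanSpace ℝ (Fin n)) :=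
    fun p => C p.1 p.2.1 ∩ Metric.closedBall 0 p.2.2
  have hD : ∀ p, IsCompact (D p) := fun p => (isCompact_closedBall _ _).inter_left (hC _ _)
  have hDS : ∀ p, D p ⊆ S p.1 := fun p => by
    rw [hSC]
    exact Set.inter_subset_left.trans (Set.subset_iUnion _ _)
  obtain ⟨a, ha⟩ := exists_surjective_nat (ι × ℕ × ℕ)
  have hED : E = ⋃ k, D (a k) := by
    rw [hE]
    ext x
    simp only [Set.mem_iUnion]
    constructor
    · rintro ⟨i, hx⟩
      rw [hSC, Set.mem_iUnion] at hx
      obtain ⟨j, hj⟩ := hx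
      obtain ⟨N, hN⟩ := exists_nat_ge ‖x‖
      obtain ⟨k, hk⟩ := ha (i, j, N)
      exact ⟨k, by rw [hk]; exact ⟨hj, by simpa using hN⟩⟩
    · rintro ⟨k, hk⟩
      exact ⟨_, hDS _ hk⟩
  choose f hlip hbd hd hosc using fun k =>
    ConeUnrectifiability.exists_oscillatesAt_of_isCompact (hD (a k)) ((hcone _).mono (hDS (a k)))
  rw [hED]
  exact ConeUnrectifiability.exists_lipschitz_of_oscillatesAt hlip hbd hd hosc
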